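/- \textbf{Theorem.} Let $L>0$, let $q\in W_2^1[0,L]$ be complex valued (identified with its continuous representative; $W_2^1[0,L]=\{f\in L_2[0,L]: f'\in L_2[0,L]\}$), and let $H\in\mathbb{C}$. For $\rho\in\mathbb{C}$ let $T(\rho,\cdot)$ and $\psi(\rho,\cdot)$ be the solutions of $-y''+q(x)y=\rho^2y$, $0<x<L$, satisfying $$T(\rho,L)=0,\quad T'(\rho,L)=1,\qquad \psi(\rho,L)=1,\quad \psi'(\rho,L)=-H .$$ Put $\operatorname{sinc}(z)=\frac{\sin \pi z}{\pi z}$ for $z\ne0$, $\operatorname{sinc}(0)=1$; let $j_1(z)=\frac{\sin z}{z^2}-\frac{\cos z}{z}$ ($j_1(0)=0$) be the spherical Bessel function of order one; and put $$\omega_L(x)=\tfrac12\int_x^L q(s)\,ds,\quad q_L(x)=\tfrac{q(x)+q(L)}{4}-\tfrac{\omega_L^2(x)}{2},\quad q_L^H(x)=\tfrac{q(x)-q(L)}{4}-\tfrac{\omega_L^2(x)}{2}-H\omega_L(x).$$ Let $x\in[0,L)$. Then \begin{align*} T(\rho,x)={}&\frac{\sin(\rho(x-L))}{\rho}+\frac{\cos(\rho(x-L))}{\rho^2}\,\omega_L(x)+\frac{\sin(\rho(x-L))}{\rho^3}\,q_L(x)\\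 &-\frac{1}{2\rho^3\sin(\rho(x-L))}\sum_{n=0}^\infty\tilde t_n(x)\Big(\operatorname{sinc}\Big(\frac{2\rho(x-L)}{\pi}-2n-1\Big)+\operatorname{sinc}\Big(\frac{2\rho(x-L)}{\pi}+2n+1\Big)\Big) \end{align*} for all $\rho\in\mathbb{C}$ with $\rho\ne0$ and $\sin(\rho(x-L))\neq0$, where for $n=0,1,\dots$ $$\tilde t_n(x)=(-1)^{n+1}\,T\Big(\frac{(2n+1)\pi}{2(x-L)},x\Big)\frac{((2n+1)\pi)^3}{4(x-L)^3}+\frac12\Big(\frac{(2n+1)\pi}{x-L}\Big)^2+2q_L(x),$$ and \begin{align*} \psi(\rho,x)={}&\cos(\rho(L-x))+\frac{\sin(\rho(L-x))}{\rho}(H+\omega_L(x))-\frac{L-x}{\rho}\,j_1(\rho(L-x))\,q_L^H(x)\\ &-\frac1{\rho^2}\sum_{n=1}^\infty\tilde\Psi_n(x)\Big(\operatorname{sinc}\Big(\frac{\rho(x-L)}{\pi}-n\Big)+\operatorname{sinc}\Big(\frac{\rho(x-L)}{\pi}+n\Big)\Big) \end{align*} for all $\rho\in\mathbb{C}\setminus\{0\}$,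 where for $n=1,2,\dots$ $$\tilde\Psi_n(x)=\Big((-1)^n-\psi\Big(\frac{n\pi}{x-L},x\Big)\Big)\Big(\frac{n\pi}{x-L}\Big)^2+(-1)^n q_L^H(x).$$ At the remaining values of $\rho$ both representations hold in the sense of limits. For the fixed $x$, each of the two series converges uniformly in $\rho$ on every compact subset of $\mathbb{C}$; for real $\rho$ it converges absolutely, uniformly on $\mathbb{R}$, and in the norm of $L_2(\mathbb{R})$. For the series of $T$ this is true both with and without the factor $\frac{1}{2\sin(\rho(x-L))}$ taken inside the series, in the first case on the set where $\sin(\rho(x-L))\ne0$. -/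

import Mathlib

open MeasureTheory Filter Topology

noncomputable section

namespace SturmLiouville

/-- `q` belongs to the Sobolev space `W₂¹[0, L]` of complex valued functions: `q` is the (absolutely
continuous) primitive on `[0, L]` of a square integrable function `g`, its weak derivative. As
usual, an element of `W₂¹[0, L]` is identified with its continuous representative, so that the
values `q x` and `q L` are meaningful. -/
def MemW12 (L : ℝ) (q : ℝ → ℂ) : Prop :=
  ∃ g : ℝ → ℂ, MemLp g 2 (volume.restrict (Set.Icc 0 L)) ∧
    ∀ x ∈ Set.Icc 0 L, q x = q 0 + ∫ s in (0 : ℝ)..x, g s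

/-- `y` is a solution on `[0, L]` of `-y'' + q y = ρ² y` (for `0 < x < L`) which is continuously
differentiable up to the end points and satisfies `y(L) = a`, `y'(L) = b`. -/
def IsSolutionFromRight (L : ℝ) (q : ℝ → ℂ) (ρ a b : ℂ) (y : ℝ → ℂ) : Prop :=
  ∃ y' y'' : ℝ → ℂ,
    (∀ x ∈ Set.Icc 0 L, HasDerivWithinAt y (y' x) (Set.Icc 0 L) x) ∧
    ContinuousOn y' (Set.Icc 0 L) ∧
    (∀ x ∈ Set.Ioo 0 L, HasDerivAt y' (y'' x) x ∧ -y'' x + q x * y x = ρ ^ 2 * y x) ∧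
    y L = a ∧ y' L = b

/-- The normalized sinc function on `ℂ`. -/
def csinc (z : ℂ) : ℂ :=
  if z = 0 then 1 else Complex.sin (Real.pi * z) / (Real.pi * z)

/-- The spherical Bessel function `j₁` (entire, with `j₁(0) = 0`). -/
def sphericalJ1 (z : ℂ) : ℂ :=
  if z = 0 then 0 else Complex.sin z / z ^ 2 - Complex.cos z / z

/-- `ω_L(x) = (1/2) ∫_x^L q(s) ds`. -/
def omegaL (L : ℝ) (q : ℝ → ℂ) (x : ℝ) : ℂ :=
  (1 / 2) * ∫ s in x..L, q s

/-- `q_L(x) = (q(x) + q(L))/4 - ω_L(x)²/2`. -/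
def qL (L : ℝ) (q : ℝ → ℂ) (x : ℝ) : ℂ :=
  (q x + q L) / 4 - omegaL L q x ^ 2 / 2

/-- `q_L^H(x) = (q(x) - q(L))/4 - ω_L(x)²/2 - H ω_L(x)`. -/
def qLH (L : ℝ) (q : ℝ → ℂ) (H : ℂ) (x : ℝ) : ℂ :=
  (q x - q L) / 4 - omegaL L q x ^ 2 / 2 - H * omegaL L q x

/-- The coefficients `t̃ₙ(x)`, `n = 0, 1, …`, of the series for `T`. -/
def tCoeff (L : ℝ) (q : ℝ → ℂ) (T : ℂ → ℝ → ℂ) (x : ℝ) (n : ℕ) : ℂ :=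
  (-1) ^ (n + 1) * T ((2 * n + 1) / (2 * ((x : ℂ) - L)) * Real.pi) x *
      (((2 * n + 1) * Real.pi) ^ 3 / (4 * ((x : ℂ) - L) ^ 3)) +
    (1 / 2) * ((2 * n + 1) / ((x : ℂ) - L) * Real.pi) ^ 2 + 2 * qL L q x

/-- The coefficients `Ψ̃ₙ(x)`, `n = 1, 2, …`, of the series for `ψ`. -/
def psiCoeff (L : ℝ) (q : ℝ → ℂ) (H : ℂ) (ψ : ℂ → ℝ → ℂ) (x : ℝ) (n : ℕ) : ℂ :=
  ((-1) ^ n - ψ (n * Real.pi / ((x : ℂ) - L)) x) * (n * Real.pi / ((x : ℂ) - L)) ^ 2 +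
    (-1) ^ n * qLH L q H x

/-- The `n`-th term, `n = 0, 1, …`, of the cardinal series for `T`. -/
def tTerm (L : ℝ) (q : ℝ → ℂ) (T : ℂ → ℝ → ℂ) (x : ℝ) (n : ℕ) (ρ : ℂ) : ℂ :=
  tCoeff L q T x n *
    (csinc (2 * ρ * ((x : ℂ) - L) / Real.pi - 2 * n - 1) +
      csinc (2 * ρ * ((x : ℂ) - L) / Real.pi + 2 * n + 1))

/-- The `n`-th term, `n = 1, 2, …`, of the cardinal series for `ψ`. -/
def psiTerm (L : ℝ) (q : ℝ → ℂ) (H : ℂ) (ψ : ℂ → ℝ → ℂ) (x : ℝ) (n : ℕ) (ρ : ℂ) : ℂ :=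
  psiCoeff L q H ψ x n *
    (csinc (ρ * ((x : ℂ) - L) / Real.pi - n) + csinc (ρ * ((x : ℂ) - L) / Real.pi + n))

/-- The series `∑ₙ u n` of functions on `ℂ` converges to `F` uniformly on every compact subset of
`ℂ`, and on the real line it converges absolutely, uniformly, and in the norm of `L₂(ℝ)`. -/
structure CardinalConverges (u : ℕ → ℂ → ℂ) (F : ℂ → ℂ) : Prop where
  uniformOn_compact : ∀ K : Set ℂ, IsCompact K →
    TendstoUniformlyOn (fun N ρ => ∑ n ∈ Finset.range N, u n ρ) F atTop K
  absolute_real : ∀ r : ℝ, Summable fun n => ‖u n (r : ℂ)‖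
  uniform_real :
    TendstoUniformly (fun N (r : ℝ) => ∑ n ∈ Finset.range N, u n (r : ℂ)) (fun r => F r) atTop
  memLp_term : ∀ n, MemLp (fun r : ℝ => u n (r : ℂ)) 2 volume
  memLp_sum : MemLp (fun r : ℝ => F (r : ℂ)) 2 volume
  tendsto_L2 : Tendsto
    (fun N => eLpNorm (fun r : ℝ => ∑ n ∈ Finset.range N, u n (r : ℂ) - F (r : ℂ)) 2 volume)
    atTop (𝓝 0)

/-- The right-hand side of the representation of `T(ρ, x)`, where `s` is the sum of its series. -/
def tExpansion (L : ℝ) (q : ℝ → ℂ) (x : ℝ) (s ρ : ℂ) : ℂ :=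
  Complex.sin (ρ * (x - L)) / ρ + Complex.cos (ρ * (x - L)) / ρ ^ 2 * omegaL L q x +
    Complex.sin (ρ * (x - L)) / ρ ^ 3 * qL L q x -
    1 / (2 * ρ ^ 3 * Complex.sin (ρ * (x - L))) * s

/-- The right-hand side of the representation of `ψ(ρ, x)`, where `s` is the sum of its series. -/
def psiExpansion (L : ℝ) (q : ℝ → ℂ) (H : ℂ) (x : ℝ) (s ρ : ℂ) : ℂ :=
  Complex.cos (ρ * (L - x)) + Complex.sin (ρ * (L - x)) / ρ * (H + omegaL L q x) -
    (L - x) / ρ * sphericalJ1 (ρ * (L - x)) * qLH L q H x - 1 / ρ ^ 2 * s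

end SturmLiouville

end

/-! ### Exponentials in `L²(-1/2, 1/2)` and the sinc function. -/

noncomputable section

namespace SturmLiouville

open scoped ComplexConjugate InnerProductSpace
open Complex Set

/-! Put s = L - x. If f(ρ) = ⟨φ, exp(iρu)⟩ with φ in L²(-s, s), then expanding φ in the orthogonal
basis of exponentials with frequencies (k + θ)π/s gives the cardinal series of f with these nodes
(`ExpBound.isCardinalSum`). The error of a partial sum is the pairing of the tail of φ with an
exponential. Cauchy-Schwarz therefore gives uniform convergence on ℝ and on compact sets, and a
Plancherel inequality (`lintegral_inner_wave_le`) gives convergence in L²(ℝ).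

It remains to see that `tRemainder` and `psiRemainder`, the errors of the asymptotics multiplied by
a power of ρ, are such transforms (`expBound_remainders`). In the variable t = L - x, both come from
the solution E with E(0) = 1, E'(0) = iρ, because T and ψ are even in ρ. Iterating the Volterra
equation of E twice, with one integration by parts that uses q' ∈ L², leaves a remainder that solves
a Volterra equation whose sources are Fourier integrals or exponentials
(`secondRemainder_volterra`).

The function φ is found by duality, without constructing a transmutation kernel: it suffices to
bound ∑ cⱼ f(ρⱼ) by the L²(-s, s) norm of W(u) = ∑ cⱼ exp(iρⱼu) (`ExpBound.exists_inner_eq`). The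
superposition U(t, u) = ∑ cⱼ g(ρⱼ, t) exp(iρⱼu) of solutions g of the Volterra equation solves a
wave equation, and U(s, 0) depends only on W on (-s, s). A Gronwall iteration on the triangle |u| +
t ≤ s gives the bound (`expBound_of_volterra`).

The series of T uses the half-integer nodes θ = 1/2, where the cosine vanishes. The series of ψ uses
θ = 0, and its j₁ term makes the node k = 0 drop out. -/

/-- The measure underlying `L²(-1/2, 1/2)`. -/
abbrev unitMeasure : Measure ℝ := volume.restrict (Ioc (-1 / 2 : ℝ) (1 / 2))

/-- The exponential `u ↦ exp(2πizu)`. -/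
def waveFun (z : ℂ) (u : ℝ) : ℂ := exp (2 * Real.pi * I * z * u)

lemma continuous_waveFun_uncurry : Continuous fun p : ℂ × ℝ => waveFun p.1 p.2 := by
  unfold waveFun; fun_prop

lemma continuous_waveFun (z : ℂ) : Continuous (waveFun z) := by
  unfold waveFun; fun_prop

lemma memLp_waveFun (z : ℂ) : MemLp (waveFun z) 2 unitMeasure := by
  have hc := continuous_waveFun z
  rw [memLp_two_iff_integrable_sq_norm hc.aestronglyMeasurable]
  exact ((hc.norm.pow 2).intervalIntegrable (-1 / 2) (1 / 2)).1

/-- The exponential `u ↦ exp(2πizu)` as an element of `L²(-1/2, 1/2)`. -/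
def wave (z : ℂ) : Lp ℂ 2 unitMeasure := (memLp_waveFun z).toLp

lemma waveFun_add (a b : ℂ) (u : ℝ) : waveFun (a + b) u = waveFun a u * waveFun b u := by
  simp only [waveFun, ← Complex.exp_add]; congr 1; ring

lemma conj_waveFun (a : ℂ) (u : ℝ) : conj (waveFun a u) = waveFun (-conj a) u := by
  simp only [waveFun, ← Complex.exp_conj]; congr 1; simp [map_ofNat]

lemma csinc_eq_integral (z : ℂ) : csinc z = ∫ u in (-1 / 2 : ℝ)..(1 / 2), waveFun z u := by
  unfold csinc waveFun
  split_ifs with h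
  · subst h; norm_num
  · have hπ : (Real.pi : ℂ) ≠ 0 := by exact_mod_cast Real.pi_ne_zero
    have hc : 2 * Real.pi * I * z ≠ 0 := by simp [h, Real.pi_ne_zero]
    rw [integral_exp_mul_complex hc, Complex.sin]
    have e1 : 2 * (Real.pi : ℂ) * I * z * ((1 / 2 : ℝ) : ℂ) = Real.pi * z * I := by push_cast; ring
    have e2 : 2 * (Real.pi : ℂ) * I * z * ((-1 / 2 : ℝ) : ℂ) = -(Real.pi * z) * I := by
      push_cast; ring
    rw [e1, e2]
    field_simp
    rw [I_sq]; ring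

lemma continuous_csinc : Continuous csinc := by
  have : csinc = fun z => ∫ u in (-1 / 2 : ℝ)..(1 / 2), waveFun z u := funext csinc_eq_integral
  rw [this]
  exact intervalIntegral.continuous_parametric_intervalIntegral_of_continuous'
    continuous_waveFun_uncurry _ _

lemma csinc_neg (z : ℂ) : csinc (-z) = csinc z := by
  simp [csinc]

lemma csinc_zero : csinc 0 = 1 := by simp [csinc]

lemma csinc_intCast {k : ℤ} (hk : k ≠ 0) : csinc k = 0 := by
  have : Complex.sin (Real.pi * k) = 0 := by
    rw [mul_comm]; exact Complex.sin_int_mul_pi k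
  simp [csinc, hk, this]

lemma inner_toLp_unit {f g : ℝ → ℂ} (hf : MemLp f 2 unitMeasure) (hg : MemLp g 2 unitMeasure) :
    ⟪hf.toLp, hg.toLp⟫_ℂ = ∫ u in (-1 / 2 : ℝ)..(1 / 2), conj (f u) * g u := by
  rw [intervalIntegral.integral_of_le (by norm_num), L2.inner_def]
  refine integral_congr_ae ?_
  filter_upwards [hf.coeFn_toLp, hg.coeFn_toLp] with u h1 h2
  rw [h1, h2, RCLike.inner_apply, mul_comm]

lemma inner_wave (a b : ℂ) : ⟪wave a, wave b⟫_ℂ = csinc (b - conj a) := by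
  rw [wave, wave, inner_toLp_unit, csinc_eq_integral]
  congr 1; ext u
  rw [conj_waveFun, ← waveFun_add, neg_add_eq_sub]

lemma norm_wave_sq (z : ℂ) : ‖wave z‖ ^ 2 = (csinc (z - conj z)).re := by
  rw [← inner_wave, ← inner_self_eq_norm_sq (𝕜 := ℂ)]; rfl

lemma norm_wave_ofReal (r : ℝ) : ‖wave r‖ = 1 := by
  have h := norm_wave_sq r
  rw [conj_ofReal, sub_self, csinc_zero, one_re] at h
  nlinarith [norm_nonneg (wave (r : ℂ))]

/-- The squared distance of two waves expands into four inner products, each a value of `csinc`. -/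
lemma continuous_wave : Continuous wave := by
  rw [continuous_iff_continuousAt]
  intro z
  rw [ContinuousAt, tendsto_iff_norm_sub_tendsto_zero]
  have key : ∀ w, ‖wave w - wave z‖ ^ 2 = (csinc (w - conj w) - csinc (w - conj z)
      - csinc (z - conj w) + csinc (z - conj z)).re := by
    intro w
    rw [← inner_self_eq_norm_sq (𝕜 := ℂ), inner_sub_left, inner_sub_right, inner_sub_right]
    simp only [inner_wave]
    simp; ring
  have hc : Continuous fun w => (csinc (w - conj w) - csinc (w - conj z)
      - csinc (z - conj w) + csinc (z - conj z)).re := by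
    have h := continuous_csinc
    have h' : Continuous (fun w : ℂ => conj w) := continuous_conj
    fun_prop
  have h0 : Tendsto (fun w => ‖wave w - wave z‖ ^ 2) (𝓝 z) (𝓝 0) := by
    simp_rw [key]
    have := hc.tendsto z
    simpa using this
  have := h0.sqrt
  simpa [Real.sqrt_sq] using this

lemma orthonormal_wave (r : ℝ) : Orthonormal ℂ fun k : ℤ => wave (r + k) := by
  rw [orthonormal_iff_ite]
  intro i j
  rw [inner_wave]
  have : (r + j - conj (r + i : ℂ) : ℂ) = ((j - i : ℤ) : ℂ) := by
    push_cast; rw [map_add, conj_ofReal, map_intCast]; ring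
  rw [this]
  split_ifs with h
  · subst h; simp [csinc_zero]
  · exact csinc_intCast (sub_ne_zero.mpr (Ne.symm h))

lemma orthonormal_wave_int : Orthonormal ℂ fun k : ℤ => wave k := by
  simpa using orthonormal_wave 0

/-- On an interval of length one these inner products are the Fourier coefficients, so Parseval's
identity forces the norm to vanish. -/
lemma span_wave_orthogonal : (Submodule.span ℂ (range fun k : ℤ => wave k))ᗮ = ⊥ := by
  rw [Submodule.eq_bot_iff]
  intro χ hχ
  rw [Submodule.mem_orthogonal] at hχ
  have hzero : ∀ k : ℤ, ⟪wave k, χ⟫_ℂ = 0 := fun k => hχ _ (Submodule.subset_span ⟨k, rfl⟩)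
  have hab : (-1 / 2 : ℝ) < 1 / 2 := by norm_num
  have hχm : MemLp χ 2 unitMeasure := Lp.memLp χ
  have hco : ∀ k, fourierCoeffOn hab χ k = 0 := by
    intro k
    rw [fourierCoeffOn_eq_integral, ← hzero k]
    conv_rhs => rw [← Lp.toLp_coeFn χ hχm, wave, inner_toLp_unit]
    norm_num
    rfl
  have hs := hasSum_sq_fourierCoeffOn hab hχm
  simp only [hco] at hs
  have h0 := hs.tsum_eq.symm
  have hnorm : ‖χ‖ ^ 2 = 0 := by
    rw [← inner_self_eq_norm_sq (𝕜 := ℂ)]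
    conv_lhs => rw [← Lp.toLp_coeFn χ hχm, inner_toLp_unit]
    norm_num at h0
    have : (fun u => conj (χ u) * χ u) = fun u => ((‖χ u‖ ^ 2 : ℝ) : ℂ) := by
      ext u; rw [mul_comm, mul_conj, normSq_eq_norm_sq]
    rw [this, intervalIntegral.integral_ofReal]
    norm_num [h0]
  simpa using hnorm

/-- The Hilbert basis `exp(2πiku)`, `k ∈ ℤ`, of `L²(-1/2, 1/2)`. -/
def waveBasis : HilbertBasis ℤ ℂ (Lp ℂ 2 unitMeasure) :=
  HilbertBasis.mkOfOrthogonalEqBot orthonormal_wave_int span_wave_orthogonal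

lemma waveBasis_apply (k : ℤ) : waveBasis k = wave k := by
  simp [waveBasis]

/-- Half of Plancherel from Bessel: cut ℝ into unit intervals and translate them all to (0, 1]. For
each r the waves at r + k, k ∈ ℤ, are orthonormal, so the sum over k is at most ‖φ‖², and the
interval has length one. -/
lemma lintegral_inner_wave_le (φ : Lp ℂ 2 unitMeasure) :
    ∫⁻ r : ℝ, ENNReal.ofReal (‖⟪φ, wave r⟫_ℂ‖ ^ 2) ≤ ENNReal.ofReal (‖φ‖ ^ 2) := by
  have hcont : Continuous fun r : ℝ => ‖⟪φ, wave r⟫_ℂ‖ ^ 2 := by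
    have := continuous_wave
    fun_prop
  have hmeas : Measurable fun r : ℝ => ENNReal.ofReal (‖⟪φ, wave r⟫_ℂ‖ ^ 2) :=
    hcont.measurable.ennreal_ofReal
  rw [← setLIntegral_univ, ← iUnion_Ioc_add_intCast (0 : ℝ),
    lintegral_iUnion (fun _ => measurableSet_Ioc) (pairwise_disjoint_Ioc_add_intCast 0)]
  have hshift : ∀ k : ℤ, ∫⁻ r in Ioc ((0 : ℝ) + k) (0 + k + 1),
      ENNReal.ofReal (‖⟪φ, wave r⟫_ℂ‖ ^ 2)
      = ∫⁻ r in Ioc (0 : ℝ) 1, ENNReal.ofReal (‖⟪φ, wave (r + k)⟫_ℂ‖ ^ 2) := by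
    intro k
    have hmp := (measurePreserving_add_right (volume : Measure ℝ) (k : ℝ)).restrict_preimage
      (measurableSet_Ioc (a := (0 : ℝ) + k) (b := 0 + k + 1))
    rw [← hmp.lintegral_comp hmeas]
    simp
  simp_rw [hshift]
  rw [← lintegral_tsum]
  · calc _ ≤ ∫⁻ r in Ioc (0 : ℝ) 1, ENNReal.ofReal (‖φ‖ ^ 2) := by
          refine lintegral_mono fun r => ?_
          rw [← ENNReal.ofReal_tsum_of_nonneg (fun _ => by positivity)]
          · refine ENNReal.ofReal_le_ofReal ?_
            simp_rw [norm_inner_symm φ]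
            exact (orthonormal_wave r).tsum_inner_products_le φ
          · simp_rw [norm_inner_symm φ]
            exact (orthonormal_wave r).inner_products_summable φ
      _ = _ := by simp
  · intro k
    have := continuous_wave
    have h2 : Continuous fun r : ℝ => ‖⟪φ, wave (r + k)⟫_ℂ‖ ^ 2 := by fun_prop
    exact h2.measurable.ennreal_ofReal.aemeasurable

lemma eLpNorm_inner_wave_le (φ : Lp ℂ 2 unitMeasure) :
    eLpNorm (fun r : ℝ => ⟪φ, wave r⟫_ℂ) 2 volume ≤ ENNReal.ofReal ‖φ‖ := by
  rw [eLpNorm_eq_lintegral_rpow_enorm_toReal (by norm_num) (by norm_num)]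
  have h := lintegral_inner_wave_le φ
  have h2 : ∀ r : ℝ, ‖⟪φ, wave r⟫_ℂ‖ₑ ^ (2 : ENNReal).toReal
      = ENNReal.ofReal (‖⟪φ, wave r⟫_ℂ‖ ^ 2) := by
    intro r
    rw [ENNReal.ofReal_pow (norm_nonneg _), ofReal_norm]; norm_num
  simp_rw [h2]
  calc _ ≤ (ENNReal.ofReal (‖φ‖ ^ 2)) ^ (1 / (2 : ENNReal).toReal) := by gcongr
    _ = _ := by
      rw [ENNReal.ofReal_rpow_of_nonneg (by positivity) (by norm_num)]
      congr 1
      rw [ENNReal.toReal_ofNat, ← Real.sqrt_eq_rpow, Real.sqrt_sq (norm_nonneg _)]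

end SturmLiouville
end

/-! ### Fourier transforms of `L²(-s, s)` and their cardinal series. -/

noncomputable section

namespace SturmLiouville

open scoped ComplexConjugate InnerProductSpace
open Complex Set

/-- `f` extends to a bounded functional on the span of the exponentials `exp(iρu)` in
`L²(-s, s)`: this says that `f` is the Fourier transform of an element of `L²(-s, s)`. -/
def ExpBound (s : ℝ) (f : ℂ → ℂ) : Prop :=
  ∃ C : ℝ, 0 ≤ C ∧ ∀ {ι : Type} (J : Finset ι) (c ρ : ι → ℂ),
    ‖∑ j ∈ J, c j * f (ρ j)‖ ^ 2 ≤
      C * ∫ u in (-s)..s, ‖∑ j ∈ J, c j * exp (I * ρ j * u)‖ ^ 2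

namespace ExpBound

variable {s : ℝ} {f g : ℂ → ℂ}

lemma congr (hf : ExpBound s f) (h : ∀ ρ, g ρ = f ρ) : ExpBound s g := by
  rwa [funext h]

lemma add (hf : ExpBound s f) (hg : ExpBound s g) : ExpBound s fun ρ => f ρ + g ρ := by
  obtain ⟨A, hA, hf⟩ := hf
  obtain ⟨B, hB, hg⟩ := hg
  refine ⟨2 * A + 2 * B, by positivity, fun J c ρ => ?_⟩
  have h1 := hf J c ρ
  have h2 := hg J c ρ
  simp only [mul_add, Finset.sum_add_distrib]
  have h3 := norm_add_le (∑ j ∈ J, c j * f (ρ j)) (∑ j ∈ J, c j * g (ρ j))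
  have h4 := norm_nonneg (∑ j ∈ J, c j * f (ρ j) + ∑ j ∈ J, c j * g (ρ j))
  nlinarith [sq_nonneg (‖∑ j ∈ J, c j * f (ρ j)‖ - ‖∑ j ∈ J, c j * g (ρ j)‖)]

lemma const_mul (hf : ExpBound s f) (a : ℂ) : ExpBound s fun ρ => a * f ρ := by
  obtain ⟨A, hA, hf⟩ := hf
  refine ⟨‖a‖ ^ 2 * A, by positivity, fun J c ρ => ?_⟩
  have h1 := hf J c ρ
  have : ∑ j ∈ J, c j * (a * f (ρ j)) = a * ∑ j ∈ J, c j * f (ρ j) := by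
    rw [Finset.mul_sum]; exact Finset.sum_congr rfl fun _ _ => by ring
  rw [this, norm_mul, mul_pow, mul_assoc]
  gcongr

lemma comp_neg (hf : ExpBound s f) : ExpBound s fun ρ => f (-ρ) := by
  obtain ⟨A, hA, hf⟩ := hf
  refine ⟨A, hA, fun J c ρ => ?_⟩
  have h1 := hf J c (fun j => -ρ j)
  refine h1.trans_eq ?_
  congr 1
  have := intervalIntegral.integral_comp_neg (a := -s) (b := s)
    (fun u : ℝ => ‖∑ j ∈ J, c j * exp (I * ρ j * u)‖ ^ 2)
  rw [neg_neg] at this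
  rw [← this]
  refine intervalIntegral.integral_congr fun u _ => ?_
  simp

lemma comp_add_ofReal (hf : ExpBound s f) (a : ℝ) : ExpBound s fun ρ => f (ρ + a) := by
  obtain ⟨A, hA, hf⟩ := hf
  refine ⟨A, hA, fun J c ρ => ?_⟩
  refine (hf J c (fun j => ρ j + a)).trans_eq ?_
  congr 1
  refine intervalIntegral.integral_congr fun u _ => ?_
  have : ∑ j ∈ J, c j * exp (I * (ρ j + a) * u)
      = exp ((a * u : ℝ) * I) * ∑ j ∈ J, c j * exp (I * ρ j * u) := by
    rw [Finset.mul_sum]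
    refine Finset.sum_congr rfl fun j _ => ?_
    rw [mul_left_comm, ← Complex.exp_add]
    congr 2; push_cast; ring
  simp only [this, norm_mul, norm_exp_ofReal_mul_I, one_mul]

lemma rescale (hf : ExpBound s f) (hs : 0 < s) :
    ∃ C : ℝ, 0 ≤ C ∧ ∀ (J : Finset ℂ) (c : ℂ → ℂ),
      ‖∑ z ∈ J, c z * f (Real.pi * z / s)‖ ^ 2 ≤
        C * ∫ u in (-1 / 2 : ℝ)..(1 / 2), ‖∑ z ∈ J, c z * waveFun z u‖ ^ 2 := by
  obtain ⟨A, hA, hf⟩ := hf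
  refine ⟨A * (2 * s), by positivity, fun J c => ?_⟩
  refine (hf J c (fun z => Real.pi * z / s)).trans_eq ?_
  rw [mul_assoc]
  congr 1
  have h := intervalIntegral.mul_integral_comp_mul_left (a := -1 / 2) (b := 1 / 2)
    (f := fun u : ℝ => ‖∑ j ∈ J, c j * exp (I * (Real.pi * j / s) * u)‖ ^ 2) (2 * s)
  have e1 : 2 * s * (-1 / 2) = -s := by ring
  have e2 : 2 * s * (1 / 2) = s := by ring
  rw [e1, e2] at h
  rw [← h]
  congr 1
  refine intervalIntegral.integral_congr fun u _ => ?_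
  have hs' : (s : ℂ) ≠ 0 := by exact_mod_cast hs.ne'
  simp only [waveFun]
  congr 3; ext z; congr 2; push_cast
  field_simp

end ExpBound

lemma norm_sq_sum_smul_wave (J : Finset ℂ) (c : ℂ → ℂ) :
    ‖∑ z ∈ J, c z • wave z‖ ^ 2
      = ∫ u in (-1 / 2 : ℝ)..(1 / 2), ‖∑ z ∈ J, c z * waveFun z u‖ ^ 2 := by
  have hm : ∀ J : Finset ℂ, ∃ h : MemLp (fun u => ∑ z ∈ J, c z * waveFun z u) 2 unitMeasure,
      ∑ z ∈ J, c z • wave z = h.toLp := by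
    intro J
    induction J using Finset.cons_induction with
    | empty => exact ⟨by simp, by simp⟩
    | cons a J ha ih =>
      obtain ⟨h, e⟩ := ih
      have h1 : MemLp (c a • waveFun a) 2 unitMeasure := (memLp_waveFun a).const_smul (c a)
      have e2 : (fun u => ∑ z ∈ Finset.cons a J ha, c z * waveFun z u)
          = c a • waveFun a + fun u => ∑ z ∈ J, c z * waveFun z u := by
        ext u; simp only [Finset.sum_cons, Pi.add_apply, Pi.smul_apply, smul_eq_mul]
      have h2 := h1.add h
      refine ⟨e2 ▸ h2, ?_⟩
      rw [Finset.sum_cons, e, wave, ← MemLp.toLp_const_smul, ← MemLp.toLp_add]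
      congr 1
      exact e2.symm
  obtain ⟨h, e⟩ := hm J
  have h3 : ((‖h.toLp‖ ^ 2 : ℝ) : ℂ) = ⟪h.toLp, h.toLp⟫_ℂ := by
    rw [inner_self_eq_norm_sq_to_K]; norm_num
  rw [e]
  have h4 := inner_toLp_unit h h
  rw [← h3] at h4
  have : ∀ w : ℂ, conj w * w = ((‖w‖ ^ 2 : ℝ) : ℂ) := by
    intro w; rw [mul_comm, mul_conj, normSq_eq_norm_sq]
  simp_rw [this] at h4
  rw [intervalIntegral.integral_ofReal] at h4
  exact_mod_cast h4

/-- The bound makes the functional on finite combinations of waves well defined and continuous on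
their span. Hahn-Banach extends it to the whole space, and the Riesz representation of the extension
is φ. -/
lemma ExpBound.exists_inner_eq {s : ℝ} {f : ℂ → ℂ} (hf : ExpBound s f) (hs : 0 < s) :
    ∃ φ : Lp ℂ 2 unitMeasure, ∀ z : ℂ, f (Real.pi * z / s) = ⟪φ, wave z⟫_ℂ := by
  obtain ⟨C, hC, hb⟩ := hf.rescale hs
  let A : (ℂ →₀ ℂ) →ₗ[ℂ] Lp ℂ 2 unitMeasure := Finsupp.linearCombination ℂ wave
  let B : (ℂ →₀ ℂ) →ₗ[ℂ] ℂ := Finsupp.linearCombination ℂ fun z => f (Real.pi * z / s)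
  have hAB : ∀ c, ‖B c‖ ≤ √C * ‖A c‖ := by
    intro c
    have h := hb c.support c
    rw [← norm_sq_sum_smul_wave] at h
    have hA : A c = ∑ z ∈ c.support, c z • wave z := rfl
    have hB : B c = ∑ z ∈ c.support, c z * f (Real.pi * z / s) := rfl
    rw [← hA, ← hB] at h
    rw [← Real.sqrt_sq (norm_nonneg (A c)), ← Real.sqrt_mul hC]
    exact Real.le_sqrt_of_sq_le h
  have hker : LinearMap.ker A ≤ LinearMap.ker B := by
    intro c hc
    have := hAB c
    rw [LinearMap.mem_ker] at hc ⊢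
    rw [hc, norm_zero, mul_zero] at this
    exact norm_le_zero_iff.mp this
  let g₀ : LinearMap.range A →ₗ[ℂ] ℂ :=
    (Submodule.liftQ _ B hker).comp A.quotKerEquivRange.symm.toLinearMap
  have hg₀ : ∀ c, g₀ ⟨A c, LinearMap.mem_range_self A c⟩ = B c := by
    intro c
    have : A.quotKerEquivRange.symm ⟨A c, LinearMap.mem_range_self A c⟩
        = (LinearMap.ker A).mkQ c := A.quotKerEquivRange_symm_apply_image c _
    simp only [g₀, LinearMap.comp_apply, LinearEquiv.coe_coe, this]
    simp
  let g : StrongDual ℂ (LinearMap.range A) := g₀.mkContinuous √C (by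
    rintro ⟨_, c, rfl⟩
    rw [hg₀]
    exact hAB c)
  obtain ⟨G, hG, -⟩ := exists_extension_norm_eq (LinearMap.range A) g
  refine ⟨(InnerProductSpace.toDual ℂ _).symm G, fun z => ?_⟩
  rw [InnerProductSpace.toDual_symm_apply]
  have hz : A (Finsupp.single z 1) = wave z := by simp [A]
  have h := hG ⟨A (Finsupp.single z 1), LinearMap.mem_range_self A _⟩
  rw [← hz, h]
  change _ = g₀ _
  rw [hg₀]
  simp [B]

/-- The function `f` and its cardinal series with nodes `(k + θ)π/s`. -/
structure IsCardinalSum (s θ : ℝ) (f : ℂ → ℂ) : Prop where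
  exists_error : ∃ (δ : Finset ℤ → ℝ) (M : ℂ → ℝ), Tendsto δ atTop (𝓝 0) ∧ Continuous M ∧
    (∀ r : ℝ, M r = 1) ∧
    (∀ (S : Finset ℤ) ρ, ‖∑ k ∈ S, f (Real.pi * (k + θ) / s) * csinc (ρ * s / Real.pi - θ - k) - f ρ‖
      ≤ δ S * M ρ) ∧
    ∀ S : Finset ℤ, eLpNorm (fun r : ℝ => ∑ k ∈ S, f (Real.pi * (k + θ) / s) *
      csinc (r * s / Real.pi - θ - k) - f r) 2 volume ≤ ENNReal.ofReal (δ S)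
  continuous : Continuous f
  memLp : MemLp (fun r : ℝ => f r) 2 volume
  memLp_term : ∀ k : ℤ, MemLp (fun r : ℝ => csinc (r * s / Real.pi - θ - k)) 2 volume

lemma eLpNorm_comp_mul_left {a : ℝ} (ha : a ≠ 0) {F : ℝ → ℂ} (hF : Continuous F) :
    eLpNorm (fun r => F (a * r)) 2 volume
      = ENNReal.ofReal √|a⁻¹| * eLpNorm F 2 volume := by
  have h := eLpNorm_map_measure (p := 2) (μ := (volume : Measure ℝ)) (f := fun r : ℝ => a * r)
    (g := F) hF.aestronglyMeasurable (by fun_prop)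
  rw [Real.map_volume_mul_left ha] at h
  rw [Function.comp_def] at h
  rw [← h, eLpNorm_smul_measure_of_ne_top (by norm_num)]
  congr 1
  rw [Real.sqrt_eq_rpow, ← ENNReal.ofReal_rpow_of_nonneg (abs_nonneg _) (by norm_num)]
  norm_num

/-- Rescaling u and translating ρ by πθ/s moves the nodes to the integers, where the waves form a
Hilbert basis. The coefficients of φ are the conjugates of the values of f at the nodes, so the
error of a partial sum is the pairing of a wave with the error of the expansion of φ. This one
quantity controls every mode of convergence. -/
lemma ExpBound.isCardinalSum {s : ℝ} {f : ℂ → ℂ} (hf : ExpBound s f) (hs : 0 < s) (θ : ℝ) :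
    IsCardinalSum s θ f := by
  obtain ⟨φ, hφ⟩ := (hf.comp_add_ofReal (Real.pi * θ / s)).exists_inner_eq hs
  have hπ := Real.pi_pos
  have hπ' : (Real.pi : ℂ) ≠ 0 := by exact_mod_cast hπ.ne'
  have hs' : (s : ℂ) ≠ 0 := by exact_mod_cast hs.ne'
  have hval : ∀ ρ : ℂ, f ρ = ⟪φ, wave (ρ * s / Real.pi - θ)⟫_ℂ := by
    intro ρ
    rw [← hφ]; congr 1; push_cast; field_simp; ring
  have hcw := continuous_wave
  have ha : s / Real.pi ≠ 0 := by positivity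
  have hLp : ∀ χ : Lp ℂ 2 unitMeasure, eLpNorm (fun r : ℝ => ⟪χ, wave (r * s / Real.pi - θ)⟫_ℂ) 2 volume
      ≤ ENNReal.ofReal (√|(s / Real.pi)⁻¹| * ‖χ‖) := by
    intro χ
    have hc : Continuous fun r : ℝ => ⟪χ, wave r⟫_ℂ := by fun_prop
    have hc' : Continuous fun r : ℝ => ⟪χ, wave (r - θ : ℝ)⟫_ℂ := by fun_prop
    have h1 := eLpNorm_comp_mul_left ha hc'
    have h2 := eLpNorm_comp_measurePreserving (p := 2) hc.aestronglyMeasurable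
      (measurePreserving_sub_right (volume : Measure ℝ) θ)
    have e : ∀ r : ℝ, ((s / Real.pi * r - θ : ℝ) : ℂ) = r * s / Real.pi - θ := by
      intro r; push_cast; ring
    simp only [e] at h1
    rw [Function.comp_def] at h2
    rw [h1, h2, ENNReal.ofReal_mul (by positivity)]
    gcongr
    exact eLpNorm_inner_wave_le χ
  have hmem : ∀ χ : Lp ℂ 2 unitMeasure,
      MemLp (fun r : ℝ => ⟪χ, wave (r * s / Real.pi - θ)⟫_ℂ) 2 volume := by
    intro χ
    have hc : Continuous fun r : ℝ => ⟪χ, wave (r * s / Real.pi - θ)⟫_ℂ := by fun_prop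
    exact ⟨hc.aestronglyMeasurable, (hLp χ).trans_lt ENNReal.ofReal_lt_top⟩
  have hsum := waveBasis.hasSum_repr φ
  set P : Finset ℤ → Lp ℂ 2 unitMeasure := fun S => ∑ k ∈ S, waveBasis.repr φ k • waveBasis k
    with hP
  have hPinner : ∀ (S : Finset ℤ) (ρ : ℂ),
      ∑ k ∈ S, f (Real.pi * (k + θ) / s) * csinc (ρ * s / Real.pi - θ - k) - f ρ
        = ⟪P S - φ, wave (ρ * s / Real.pi - θ)⟫_ℂ := by
    intro S ρ
    rw [inner_sub_left, ← hval, hP, sum_inner]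
    congr 1
    refine Finset.sum_congr rfl fun k _ => ?_
    rw [inner_smul_left, HilbertBasis.repr_apply_apply, waveBasis_apply, inner_conj_symm, ← hφ,
      inner_wave, map_intCast]
    congr 2
    push_cast; field_simp
  have hδ : Tendsto (fun S => ‖P S - φ‖) atTop (𝓝 0) :=
    tendsto_iff_norm_sub_tendsto_zero.mp hsum
  -- The square root is the scaling factor in the L² bound. Adding 1 makes the same δ dominate the
  -- pointwise error too. M is the norm of the wave, which equals 1 for real ρ.
  refine ⟨⟨fun S => (√|(s / Real.pi)⁻¹| + 1) * ‖P S - φ‖, fun ρ => ‖wave (ρ * s / Real.pi - θ)‖,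
    by simpa using hδ.const_mul (√|(s / Real.pi)⁻¹| + 1), by fun_prop, ?_, ?_, ?_⟩, ?_, ?_, ?_⟩
  · intro r
    have e : (r * s / Real.pi - θ : ℂ) = ((r * s / Real.pi - θ : ℝ) : ℂ) := by push_cast; ring
    simp only [e]
    exact norm_wave_ofReal _
  · intro S ρ
    rw [hPinner]
    refine (norm_inner_le_norm _ _).trans ?_
    gcongr
    exact le_mul_of_one_le_left (norm_nonneg _) (by linarith [Real.sqrt_nonneg |(s / Real.pi)⁻¹|])
  · intro S
    simp_rw [hPinner]
    refine (hLp _).trans (ENNReal.ofReal_le_ofReal ?_)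
    gcongr
    linarith
  · rw [funext hval]; fun_prop
  · simp_rw [hval]; exact hmem φ
  · intro k
    have := hmem (wave k)
    simpa [inner_wave] using this

lemma ExpBound.continuous {s : ℝ} {f : ℂ → ℂ} (hf : ExpBound s f) (hs : 0 < s) : Continuous f :=
  (hf.isCardinalSum hs 0).continuous

end SturmLiouville
end

/-! ### Passage from sums over ℤ to series of paired terms. -/

noncomputable section

namespace SturmLiouville

open scoped ComplexConjugate InnerProductSpace
open Complex Set

lemma IsCardinalSum.cardinalConverges {s θ : ℝ} {f : ℂ → ℂ} (h : IsCardinalSum s θ f)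
    {S : ℕ → Finset ℤ} (hS : Tendsto S atTop atTop) {u : ℕ → ℂ → ℂ}
    (hsum : ∀ N ρ, ∑ n ∈ Finset.range N, u n ρ
      = ∑ k ∈ S N, f (Real.pi * (k + θ) / s) * csinc (ρ * s / Real.pi - θ - k))
    {a b : ℕ → ℤ} (ha : Function.Injective a) (hb : Function.Injective b)
    (hu : ∀ n ρ, u n ρ = f (Real.pi * (a n + θ) / s) * csinc (ρ * s / Real.pi - θ - a n)
      + f (Real.pi * (b n + θ) / s) * csinc (ρ * s / Real.pi - θ - b n)) :
    CardinalConverges u f := by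
  obtain ⟨δ, M, hδ, hM, hM1, herr, hL2⟩ := h.exists_error
  have hδS : Tendsto (fun N => δ (S N)) atTop (𝓝 0) := hδ.comp hS
  have hHas : ∀ ρ, HasSum (fun k : ℤ => f (Real.pi * (k + θ) / s) *
      csinc (ρ * s / Real.pi - θ - k)) (f ρ) := by
    intro ρ
    rw [HasSum, SummationFilter.unconditional_filter, tendsto_iff_norm_sub_tendsto_zero]
    exact squeeze_zero (fun _ => norm_nonneg _) (fun S => herr S ρ)
      (by simpa using hδ.mul_const (M ρ))
  refine ⟨?_, ?_, ?_, ?_, h.memLp, ?_⟩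
  · intro K hK
    obtain ⟨B, hB⟩ := hK.exists_bound_of_continuousOn hM.continuousOn
    rw [Metric.tendstoUniformlyOn_iff]
    intro ε hε
    have hev : ∀ᶠ N in atTop, |δ (S N)| < ε / (|B| + 1) := by
      have h0 := hδS.abs
      rw [abs_zero] at h0
      exact h0.eventually_lt_const (by positivity)
    filter_upwards [hev] with N hN ρ hρ
    rw [dist_comm, dist_eq_norm, hsum]
    calc _ ≤ δ (S N) * M ρ := herr _ _
      _ ≤ |δ (S N)| * |M ρ| := by rw [← abs_mul]; exact le_abs_self _
      _ ≤ |δ (S N)| * (|B| + 1) := by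
        gcongr
        have := hB ρ hρ
        rw [Real.norm_eq_abs] at this
        linarith [le_abs_self B]
      _ < ε := by rwa [lt_div_iff₀ (by positivity)] at hN
  · intro r
    -- The limit along all finite sets of nodes is unconditional summability, which in ℂ is
    -- absolute.
    have hn := (hHas r).summable.norm
    refine Summable.of_nonneg_of_le (fun _ => norm_nonneg _) (fun n => ?_)
      ((hn.comp_injective ha).add (hn.comp_injective hb))
    rw [hu]
    exact norm_add_le _ _
  · rw [Metric.tendstoUniformly_iff]
    intro ε hε
    filter_upwards [hδS.eventually_lt_const hε] with N hN r
    rw [dist_comm, dist_eq_norm, hsum]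
    refine (herr _ _).trans_lt ?_
    rwa [hM1, mul_one]
  · intro n
    simp_rw [hu]
    exact ((h.memLp_term _).const_mul _).add ((h.memLp_term _).const_mul _)
  · simp_rw [hsum]
    refine tendsto_of_tendsto_of_tendsto_of_le_of_le tendsto_const_nhds ?_ (fun _ => zero_le)
      (fun N => hL2 (S N))
    simpa [Function.comp_def] using (ENNReal.continuous_ofReal.tendsto 0).comp hδS

/-- Continuity of b is not required: one of the factors used later jumps at the zeros of a sine. -/
lemma CardinalConverges.mul {u : ℕ → ℂ → ℂ} {F b : ℂ → ℂ} (h : CardinalConverges u F)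
    (hb : ∀ K : Set ℂ, IsCompact K → ∃ C : ℝ, ∀ ρ ∈ K, ‖b ρ‖ ≤ C)
    {B : ℝ} (hB : ∀ r : ℝ, ‖b r‖ ≤ B) (hm : Measurable fun r : ℝ => b r) :
    CardinalConverges (fun n ρ => b ρ * u n ρ) (fun ρ => b ρ * F ρ) := by
  have hB0 : 0 ≤ B := (norm_nonneg _).trans (hB 0)
  have hmem : ∀ {v : ℝ → ℂ}, MemLp v 2 volume → MemLp (fun r : ℝ => b r * v r) 2 volume := by
    intro v hv
    refine MemLp.of_le_mul (c := B) hv (hm.aestronglyMeasurable.mul hv.1) ?_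
    filter_upwards with r
    rw [norm_mul]
    gcongr
    exact hB r
  refine ⟨?_, ?_, ?_, fun n => hmem (h.memLp_term n), hmem h.memLp_sum, ?_⟩
  · intro K hK
    obtain ⟨C, hC⟩ := hb K hK
    have h1 := h.uniformOn_compact K hK
    rw [Metric.tendstoUniformlyOn_iff] at h1 ⊢
    intro ε hε
    filter_upwards [h1 (ε / (|C| + 1)) (by positivity)] with N hN ρ hρ
    have h2 := hN ρ hρ
    rw [dist_eq_norm] at h2 ⊢
    rw [← Finset.mul_sum, ← mul_sub, norm_mul]
    calc _ ≤ (|C| + 1) * ‖F ρ - ∑ n ∈ Finset.range N, u n ρ‖ := by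
          gcongr; linarith [hC ρ hρ, le_abs_self C]
      _ < ε := by rwa [lt_div_iff₀' (by positivity)] at h2
  · intro r
    simp_rw [norm_mul]
    exact (h.absolute_real r).mul_left _
  · have h1 := h.uniform_real
    rw [Metric.tendstoUniformly_iff] at h1 ⊢
    intro ε hε
    filter_upwards [h1 (ε / (B + 1)) (by positivity)] with N hN r
    have h2 := hN r
    rw [dist_eq_norm] at h2 ⊢
    rw [← Finset.mul_sum, ← mul_sub, norm_mul]
    calc _ ≤ (B + 1) * ‖F r - ∑ n ∈ Finset.range N, u n r‖ := by
          gcongr; linarith [hB r]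
      _ < ε := by rwa [lt_div_iff₀' (by positivity)] at h2
  · have h1 := ENNReal.Tendsto.const_mul (a := ENNReal.ofReal B) h.tendsto_L2
      (Or.inr ENNReal.ofReal_ne_top)
    rw [mul_zero] at h1
    refine tendsto_of_tendsto_of_tendsto_of_le_of_le tendsto_const_nhds h1 (fun _ => zero_le)
      (fun N => ?_)
    refine eLpNorm_le_mul_eLpNorm_of_ae_le_mul ?_ 2
    filter_upwards with r
    rw [← Finset.mul_sum, ← mul_sub, norm_mul]
    gcongr
    exact hB r

lemma CardinalConverges.congr {u v : ℕ → ℂ → ℂ} {F G : ℂ → ℂ} (h : CardinalConverges u F)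
    (huv : ∀ n ρ, v n ρ = u n ρ) (hFG : ∀ ρ, G ρ = F ρ) : CardinalConverges v G := by
  have e1 : v = u := by ext n ρ; exact huv n ρ
  have e2 : G = F := funext hFG
  rwa [e1, e2]

/-- The half-open window suits the shift 1/2: the nodes k + 1/2 and (-k - 1) + 1/2 are opposite, and
both indices lie in it or neither does. -/
lemma tendsto_Ico_neg_atTop :
    Tendsto (fun N : ℕ => Finset.Ico (-N : ℤ) N) atTop atTop := by
  refine tendsto_atTop_finset_of_monotone ?_ ?_
  · intro a b hab
    exact Finset.Ico_subset_Ico (by lia) (by lia)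
  · intro k
    exact ⟨k.natAbs + 1, by rw [Finset.mem_Ico]; lia⟩

lemma tendsto_Icc_neg_atTop :
    Tendsto (fun N : ℕ => Finset.Icc (-N : ℤ) N) atTop atTop := by
  refine tendsto_atTop_finset_of_monotone ?_ ?_
  · intro a b hab
    exact Finset.Icc_subset_Icc (by lia) (by lia)
  · intro k
    exact ⟨k.natAbs, by rw [Finset.mem_Icc]; lia⟩

lemma sum_Ico_neg_eq (v : ℤ → ℂ) (N : ℕ) :
    ∑ k ∈ Finset.Ico (-N : ℤ) N, v k
      = ∑ n ∈ Finset.range N, (v n + v (-n - 1)) := by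
  induction N with
  | zero => simp
  | succ N ih =>
    have e : Finset.Ico (-(N + 1 : ℕ) : ℤ) (N + 1 : ℕ)
        = insert (N : ℤ) (insert (-N - 1 : ℤ) (Finset.Ico (-N : ℤ) N)) := by
      ext k; simp only [Finset.mem_insert, Finset.mem_Ico]; lia
    rw [e, Finset.sum_insert, Finset.sum_insert, ih, Finset.sum_range_succ]
    · ring
    · simp
    · simp only [Finset.mem_insert, Finset.mem_Ico]; lia

lemma sum_Icc_neg_eq (v : ℤ → ℂ) (N : ℕ) :
    ∑ k ∈ Finset.Icc (-N : ℤ) N, v k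
      = v 0 + ∑ n ∈ Finset.range N, (v (n + 1) + v (-(n + 1))) := by
  induction N with
  | zero => simp
  | succ N ih =>
    have e : Finset.Icc (-(N + 1 : ℕ) : ℤ) (N + 1 : ℕ)
        = insert (N + 1 : ℤ) (insert (-(N + 1) : ℤ) (Finset.Icc (-N : ℤ) N)) := by
      ext k; simp only [Finset.mem_insert, Finset.mem_Icc]; lia
    rw [e, Finset.sum_insert, Finset.sum_insert, ih, Finset.sum_range_succ]
    · ring
    · simp
    · simp only [Finset.mem_insert, Finset.mem_Icc]; lia

end SturmLiouville
end

/-! ### Normalization of `ExpBound`, and the kernel sin(ρt)/ρ. -/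

noncomputable section

namespace SturmLiouville

open Complex Set

/-- By homogeneity it is enough to treat energy at most 1, where inhomogeneous estimates such as
|aW| ≤ |a|² + |W|² are admissible. Dividing by √(E + η) and letting η tend to 0 covers combinations
of zero energy. -/
lemma ExpBound.of_normalized {s : ℝ} {f : ℂ → ℂ} {K : ℝ}
    (h : ∀ {ι : Type} (J : Finset ι) (c ρ : ι → ℂ),
      ∫ u in (-s)..s, ‖∑ j ∈ J, c j * exp (I * ρ j * u)‖ ^ 2 ≤ 1 → ‖∑ j ∈ J, c j * f (ρ j)‖ ≤ K)
    (hs : 0 ≤ s) : ExpBound s f := by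
  refine ⟨K ^ 2, by positivity, fun J c ρ => ?_⟩
  set E := ∫ u in (-s)..s, ‖∑ j ∈ J, c j * exp (I * ρ j * u)‖ ^ 2 with hE
  have hE0 : 0 ≤ E := intervalIntegral.integral_nonneg (by linarith) fun _ _ => by positivity
  have key : ∀ η, 0 < η → ‖∑ j ∈ J, c j * f (ρ j)‖ ^ 2 ≤ K ^ 2 * (E + η) := by
    intro η hη
    have hpos : 0 < √(E + η) := Real.sqrt_pos.mpr (by linarith)
    have hsq : √(E + η) ^ 2 = E + η := Real.sq_sqrt (by linarith)
    have e1 : ∀ F : _ → ℂ, ∑ j ∈ J, (((√(E + η))⁻¹ : ℝ) : ℂ) * c j * F j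
        = (((√(E + η))⁻¹ : ℝ) : ℂ) * ∑ j ∈ J, c j * F j := by
      intro F; rw [Finset.mul_sum]; exact Finset.sum_congr rfl fun _ _ => by ring
    have h1 := h J (fun j => (((√(E + η))⁻¹ : ℝ) : ℂ) * c j) ρ
    simp only [e1, norm_mul, norm_real, norm_inv, Real.norm_eq_abs, abs_of_pos hpos, mul_pow,
      inv_pow, hsq] at h1
    rw [intervalIntegral.integral_const_mul, ← hE] at h1
    have h2 := h1 (by rw [inv_mul_le_iff₀ (by linarith)]; linarith)
    rw [inv_mul_le_iff₀ hpos] at h2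
    calc _ ≤ (√(E + η) * K) ^ 2 := by gcongr
      _ = _ := by rw [mul_pow, hsq]; ring
  have hlim : Tendsto (fun η : ℝ => K ^ 2 * (E + η)) (𝓝[>] 0) (𝓝 (K ^ 2 * (E + 0))) :=
    ((by fun_prop : Continuous fun η : ℝ => K ^ 2 * (E + η)).tendsto 0).mono_left
      nhdsWithin_le_nhds
  rw [add_zero] at hlim
  exact ge_of_tendsto hlim (by filter_upwards [self_mem_nhdsWithin] with η hη using key η hη)

/-- The entire function `ρ ↦ sin(ρt)/ρ`. -/
def sinKernel (ρ : ℂ) (t : ℝ) : ℂ := (1 / 2) * ∫ v in (-t)..t, exp (I * ρ * v)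

lemma mul_sinKernel (ρ : ℂ) (t : ℝ) : ρ * sinKernel ρ t = Complex.sin (ρ * t) := by
  unfold sinKernel
  by_cases h : ρ = 0
  · simp [h]
  · have hc : I * ρ ≠ 0 := by simp [h]
    rw [integral_exp_mul_complex hc, Complex.sin]
    have e1 : I * ρ * (t : ℂ) = ρ * t * I := by ring
    have e2 : I * ρ * ((-t : ℝ) : ℂ) = -(ρ * t) * I := by push_cast; ring
    rw [e1, e2]
    field_simp
    rw [I_sq]; ring

lemma hasDerivAt_sinKernel (ρ : ℂ) (t : ℝ) :
    HasDerivAt (sinKernel ρ) (Complex.cos (ρ * t)) t := by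
  have hc : Continuous fun v : ℝ => exp (I * ρ * v) := by fun_prop
  have h1 : ∀ t : ℝ, HasDerivAt (fun t => ∫ v in (0 : ℝ)..t, exp (I * ρ * v))
      (exp (I * ρ * t)) t := fun t =>
    intervalIntegral.integral_hasDerivAt_right (hc.intervalIntegrable _ _)
      (hc.stronglyMeasurableAtFilter _ _) hc.continuousAt
  have h2 := (h1 (-t)).scomp t (hasDerivAt_neg t)
  have h3 := ((h1 t).sub h2).const_mul (1 / 2 : ℂ)
  have e : sinKernel ρ = fun y : ℝ => (1 / 2 : ℂ) * (((fun t => ∫ v in (0 : ℝ)..t, exp (I * ρ * v)) -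
      (fun t => ∫ v in (0 : ℝ)..t, exp (I * ρ * v)) ∘ Neg.neg) y) := by
    ext y
    simp only [sinKernel, Pi.sub_apply, Function.comp_apply]
    rw [intervalIntegral.integral_interval_sub_left (hc.intervalIntegrable _ _)
      (hc.intervalIntegrable _ _)]
  rw [e]
  refine h3.congr_deriv ?_
  simp only [neg_smul, one_smul, sub_neg_eq_add, Complex.cos]
  have e1 : I * ρ * (t : ℂ) = ρ * t * I := by ring
  have e2 : I * ρ * ((-t : ℝ) : ℂ) = -(ρ * t) * I := by push_cast; ring
  rw [e1, e2]; ring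

@[fun_prop]
lemma continuous_sinKernel (ρ : ℂ) : Continuous (sinKernel ρ) :=
  continuous_iff_continuousAt.mpr fun t => (hasDerivAt_sinKernel ρ t).continuousAt

lemma sinKernel_zero (ρ : ℂ) : sinKernel ρ 0 = 0 := by simp [sinKernel]

end SturmLiouville
end

/-! ### Energy bounds for the wave equation on the triangle of dependence. -/

noncomputable section

namespace SturmLiouville

open Complex Set

/-- A function on the domain of dependence which satisfies the integral inequality of a
one-dimensional wave equation is bounded in terms of the source. -/
lemma wave_bound {s Q C₀ A₀ : ℝ} (hs : 0 ≤ s) (hQ : 0 ≤ Q) {U : ℝ → ℝ → ℂ}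
    (hA₀ : ∀ t ∈ Icc 0 s, ∀ u, |u| + t ≤ s → ‖U t u‖ ≤ A₀)
    (hstep : ∀ A : ℝ → ℝ, Continuous A →
      (∀ t ∈ Icc 0 s, ∀ u, |u| + t ≤ s → ‖U t u‖ ≤ A t) →
      ∀ t ∈ Icc 0 s, ∀ u, |u| + t ≤ s → ‖U t u‖ ≤ C₀ + ∫ τ in (0 : ℝ)..t, Q * A τ) :
    ‖U s 0‖ ≤ 2 * C₀ * Real.exp ((2 * Q + 1) * s) := by
  -- With the weight exp(lt), one application of `hstep` contracts by Q/l ≤ 1/2. The a priori bound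
  -- A₀ is halved each time and disappears in the limit, leaving 2C₀.
  set l := 2 * Q + 1 with hl
  have hl0 : 0 < l := by positivity
  have h0A : 0 ≤ A₀ := (norm_nonneg _).trans (hA₀ s ⟨hs, le_rfl⟩ 0 (by simp))
  have hC₀ : 0 ≤ C₀ := by
    have := hstep (fun _ => A₀) continuous_const hA₀ 0 ⟨le_rfl, hs⟩ 0 (by simpa using hs)
    simp only [intervalIntegral.integral_same, add_zero] at this
    exact (norm_nonneg _).trans this
  have hone : ∀ t ∈ Icc 0 s, 1 ≤ Real.exp (l * t) := fun t ht =>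
    Real.one_le_exp (mul_nonneg hl0.le ht.1)
  have key : ∀ n : ℕ, ∀ t ∈ Icc 0 s, ∀ u, |u| + t ≤ s →
      ‖U t u‖ ≤ (2 * C₀ + A₀ * (1 / 2) ^ n) * Real.exp (l * t) := by
    intro n
    induction n with
    | zero =>
      intro t ht u hu
      have h1 := hA₀ t ht u hu
      have h2 := hone t ht
      rw [pow_zero, mul_one]
      nlinarith
    | succ n ih =>
      intro t ht u hu
      refine (hstep _ (by fun_prop) ih t ht u hu).trans ?_
      have hi : ∫ τ in (0 : ℝ)..t, Q * ((2 * C₀ + A₀ * (1 / 2) ^ n) * Real.exp (l * τ))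
          = Q * (2 * C₀ + A₀ * (1 / 2) ^ n) * ((Real.exp (l * t) - 1) / l) := by
        simp_rw [← mul_assoc]
        rw [intervalIntegral.integral_const_mul, intervalIntegral.integral_comp_mul_left Real.exp
          hl0.ne', integral_exp, mul_zero, Real.exp_zero, smul_eq_mul, inv_mul_eq_div]
      rw [hi, pow_succ]
      have h2 := hone t ht
      set D := 2 * C₀ + A₀ * (1 / 2) ^ n with hD
      have hD0 : 0 ≤ D := by positivity
      have h3 : Q * D * ((Real.exp (l * t) - 1) / l) ≤ D / 2 * Real.exp (l * t) := by
        rw [← mul_div_assoc, div_le_iff₀ hl0]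
        have h4 : Q * D * (Real.exp (l * t) - 1) ≤ Q * D * Real.exp (l * t) := by
          gcongr; linarith
        have h5 : 0 ≤ D * Real.exp (l * t) := by positivity
        nlinarith
      nlinarith
  have hlim : Tendsto (fun n : ℕ => (2 * C₀ + A₀ * (1 / 2) ^ n) * Real.exp (l * s)) atTop
      (𝓝 ((2 * C₀ + A₀ * 0) * Real.exp (l * s))) :=
    ((((tendsto_pow_atTop_nhds_zero_of_lt_one (by norm_num) (by norm_num)).const_mul A₀).const_add
      (2 * C₀)).mul_const _)
  rw [mul_zero, add_zero] at hlim
  exact ge_of_tendsto' hlim fun n => key n s ⟨hs, le_rfl⟩ 0 (by simp)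

/-- The argument v = u + 2τ - t runs over [u - t, u + t], which lies in [-s, s] because |u| + t ≤ s.
After |aW| ≤ |a|² + |W|², substituting v bounds the second part by half the energy of W. -/
lemma norm_integral_mul_le_half {a W : ℝ → ℂ} {s t u : ℝ} (ht : t ∈ Icc 0 s) (hu : |u| + t ≤ s)
    (ha : IntervalIntegrable (fun τ => ‖a τ‖ ^ 2) volume 0 s) (hW : Continuous W)
    (hJ : ∫ v in (-s)..s, ‖W v‖ ^ 2 ≤ 1) :
    ‖∫ τ in (0 : ℝ)..t, a τ * W (u + 2 * τ - t)‖ ≤ (∫ τ in (0 : ℝ)..s, ‖a τ‖ ^ 2) + 1 := by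
  have hu' := abs_le.mp (show |u| ≤ s - t by linarith)
  have hWi : ∀ a b, IntervalIntegrable (fun v => ‖W v‖ ^ 2) volume a b := fun a b =>
    (hW.norm.pow 2).intervalIntegrable a b
  have hat : IntervalIntegrable (fun τ => ‖a τ‖ ^ 2) volume 0 t :=
    ha.mono_set (by rw [uIcc_of_le ht.1, uIcc_of_le (ht.1.trans ht.2)]; exact Icc_subset_Icc_right ht.2)
  have hW2 : IntervalIntegrable (fun τ => ‖W (u + 2 * τ - t)‖ ^ 2) volume 0 t :=
    (by fun_prop : Continuous fun τ => ‖W (u + 2 * τ - t)‖ ^ 2).intervalIntegrable _ _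
  have h1 : ‖∫ τ in (0 : ℝ)..t, a τ * W (u + 2 * τ - t)‖
      ≤ ∫ τ in (0 : ℝ)..t, (‖a τ‖ ^ 2 + ‖W (u + 2 * τ - t)‖ ^ 2) := by
    refine intervalIntegral.norm_integral_le_of_norm_le ht.1 ?_ (hat.add hW2)
    filter_upwards with τ _
    rw [norm_mul]
    nlinarith [sq_nonneg (‖a τ‖ - ‖W (u + 2 * τ - t)‖), sq_nonneg ‖a τ‖,
      sq_nonneg ‖W (u + 2 * τ - t)‖]
  rw [intervalIntegral.integral_add hat hW2] at h1
  have h2 : ∫ τ in (0 : ℝ)..t, ‖a τ‖ ^ 2 ≤ ∫ τ in (0 : ℝ)..s, ‖a τ‖ ^ 2 :=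
    intervalIntegral.integral_mono_interval le_rfl ht.1 ht.2
      (ae_of_all _ fun _ => by positivity) ha
  have h3 := intervalIntegral.integral_comp_add_mul (a := 0) (b := t) (fun v => ‖W v‖ ^ 2)
    (c := 2) two_ne_zero (u - t)
  have h4 : ∀ τ : ℝ, u - t + 2 * τ = u + 2 * τ - t := fun τ => by ring
  simp only [h4] at h3
  rw [h3] at h1
  have h5 : ∫ v in (u + 2 * 0 - t)..(u + 2 * t - t), ‖W v‖ ^ 2 ≤ ∫ v in (-s)..s, ‖W v‖ ^ 2 :=
    intervalIntegral.integral_mono_interval (by linarith) (by linarith [ht.1]) (by linarith)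
      (ae_of_all _ fun _ => by positivity) (hWi _ _)
  have h6 : 0 ≤ ∫ v in (u + 2 * 0 - t)..(u + 2 * t - t), ‖W v‖ ^ 2 :=
    intervalIntegral.integral_nonneg (by linarith [ht.1]) fun _ _ => by positivity
  have h7 := h5.trans hJ
  rw [smul_eq_mul] at h1
  generalize (∫ v in (u + 2 * 0 - t)..(u + 2 * t - t), ‖W v‖ ^ 2) = E at h1 h6 h7
  linarith

lemma integral_norm_le_of_sq {W : ℝ → ℂ} {s α β : ℝ} (hα : -s ≤ α) (hαβ : α ≤ β) (hβ : β ≤ s)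
    (hW : Continuous W) (hJ : ∫ v in (-s)..s, ‖W v‖ ^ 2 ≤ 1) :
    ∫ v in α..β, ‖W v‖ ≤ 2 * s + 1 := by
  have h1 : ∫ v in α..β, ‖W v‖ ≤ ∫ v in (-s)..s, ‖W v‖ :=
    intervalIntegral.integral_mono_interval hα hαβ hβ (ae_of_all _ fun _ => norm_nonneg _)
      (hW.norm.intervalIntegrable _ _)
  have h2 : ∫ v in (-s)..s, ‖W v‖ ≤ ∫ v in (-s)..s, (1 + ‖W v‖ ^ 2) := by
    refine intervalIntegral.integral_mono (by linarith) (hW.norm.intervalIntegrable _ _)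
      ((by fun_prop : Continuous fun v => 1 + ‖W v‖ ^ 2).intervalIntegrable _ _) fun v => ?_
    nlinarith [sq_nonneg (‖W v‖ - 1), norm_nonneg (W v)]
  have hi : IntervalIntegrable (fun v => ‖W v‖ ^ 2) volume (-s) s :=
    (hW.norm.pow 2).intervalIntegrable _ _
  rw [intervalIntegral.integral_add (by simp) hi, intervalIntegral.integral_const, smul_eq_mul] at h2
  linarith

/-- The solution of a Volterra equation `g = g₀ + ∫ sin(ρ(t-τ))/ρ q g dτ` is the Fourier transform
of an element of `L²(-s, s)` whenever the source `g₀` is one of the special kind below. -/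
theorem expBound_of_volterra {s : ℝ} (hs : 0 < s) {a b₁ b₂ q : ℝ → ℂ}
    (ha : MemLp a 2 (volume.restrict (Icc 0 s)))
    (hb₁ : ContinuousOn b₁ (Icc 0 s)) (hb₂ : ContinuousOn b₂ (Icc 0 s))
    (hq : ContinuousOn q (Icc 0 s)) {g : ℂ → ℝ → ℂ} (hg : ∀ ρ, ContinuousOn (g ρ) (Icc 0 s))
    (heq : ∀ ρ, ∀ t ∈ Icc 0 s, g ρ t = (∫ τ in (0 : ℝ)..t, a τ * exp (I * ρ * (2 * τ - t))) +
      ∫ τ in (0 : ℝ)..t, sinKernel ρ (t - τ) *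
        (b₁ τ * exp (I * ρ * τ) + b₂ τ * exp (-(I * ρ * τ)) + q τ * g ρ τ)) :
    ExpBound s fun ρ => g ρ s := by
  obtain ⟨B₁, hB₁⟩ := isCompact_Icc.exists_bound_of_continuousOn hb₁
  obtain ⟨B₂, hB₂⟩ := isCompact_Icc.exists_bound_of_continuousOn hb₂
  obtain ⟨Q, hQ⟩ := isCompact_Icc.exists_bound_of_continuousOn hq
  have h0mem : (0 : ℝ) ∈ Icc 0 s := ⟨le_rfl, hs.le⟩
  have hB₁0 := (norm_nonneg _).trans (hB₁ 0 h0mem)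
  have hB₂0 := (norm_nonneg _).trans (hB₂ 0 h0mem)
  have hQ0 := (norm_nonneg _).trans (hQ 0 h0mem)
  have haI : IntervalIntegrable (fun τ => ‖a τ‖ ^ 2) volume 0 s := by
    rw [intervalIntegrable_iff_integrableOn_Icc_of_le hs.le]
    exact (memLp_two_iff_integrable_sq_norm ha.1).mp ha
  have ha1 : IntervalIntegrable a volume 0 s := by
    rw [intervalIntegrable_iff_integrableOn_Icc_of_le hs.le]
    exact ha.integrable (by norm_num)
  set C₀ := ((∫ τ in (0 : ℝ)..s, ‖a τ‖ ^ 2) + 1) + s * (B₁ + B₂) * (2 * s + 1) with hC₀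
  refine ExpBound.of_normalized (K := 2 * C₀ * Real.exp ((2 * (s * Q) + 1) * s)) ?_ hs.le
  intro ι J c ρ hJ
  set W : ℝ → ℂ := fun u => ∑ j ∈ J, c j * exp (I * ρ j * u) with hW
  have hWc : Continuous W := by rw [hW]; fun_prop
  -- U is the superposition that satisfies U_tt - U_uu = qU + sources in integrated form.
  -- Multiplication by exp(iρⱼv) acts on it as translation of u by v.
  set U : ℝ → ℝ → ℂ := fun t u => ∑ j ∈ J, c j * g (ρ j) t * exp (I * ρ j * u) with hU
  have hU0 : ∑ j ∈ J, c j * g (ρ j) s = U s 0 := by simp [hU]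
  rw [hU0]
  have hUc : ContinuousOn (fun p : ℝ × ℝ => U p.1 p.2) (Icc 0 s ×ˢ Icc (-s) s) := by
    rw [hU]
    refine continuousOn_finsetSum _ fun j _ => ?_
    have h1 : ContinuousOn (fun p : ℝ × ℝ => g (ρ j) p.1) (Icc 0 s ×ˢ Icc (-s) s) :=
      (hg (ρ j)).comp continuousOn_fst fun p hp => hp.1
    exact (continuousOn_const.mul h1).mul (by fun_prop)
  -- A₀ depends on c and ρ, but the conclusion of `wave_bound` does not involve it.
  obtain ⟨A₀, hA₀⟩ := (isCompact_Icc.prod isCompact_Icc).exists_bound_of_continuousOn hUc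
  refine wave_bound (A₀ := A₀) hs.le (by positivity) (fun t ht u hu => ?_) ?_
  · exact hA₀ (t, u) ⟨ht, abs_le.mp (by linarith [ht.1])⟩
  intro A hAc hA t ht u hu
  have hu' := abs_le.mp (show |u| ≤ s - t by linarith)
  have hsub : Icc 0 t ⊆ Icc 0 s := Icc_subset_Icc_right ht.2
  have huI : uIcc 0 t = Icc 0 t := uIcc_of_le ht.1
  set X : ι → ℝ → ℂ := fun j τ =>
    b₁ τ * exp (I * ρ j * τ) + b₂ τ * exp (-(I * ρ j * τ)) + q τ * g (ρ j) τ with hX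
  have hXc : ∀ j, ContinuousOn (X j) (Icc 0 s) := by
    intro j
    have := hg (ρ j)
    rw [hX]; fun_prop
  set D : ℝ → ℂ := fun τ => ∑ j ∈ J, c j * exp (I * ρ j * u) * (sinKernel (ρ j) (t - τ) * X j τ)
    with hD
  have hUt : U t u = (∫ τ in (0 : ℝ)..t, a τ * W (u + 2 * τ - t)) + ∫ τ in (0 : ℝ)..t, D τ := by
    have e1 : ∀ τ : ℝ, a τ * W (u + 2 * τ - t)
        = ∑ j ∈ J, c j * exp (I * ρ j * u) * (a τ * exp (I * ρ j * (2 * τ - t))) := by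
      intro τ
      rw [hW, Finset.mul_sum]
      refine Finset.sum_congr rfl fun j _ => ?_
      have : I * ρ j * ((u + 2 * τ - t : ℝ) : ℂ) = I * ρ j * u + I * ρ j * (2 * τ - t) := by
        push_cast; ring
      rw [this, Complex.exp_add]; ring
    simp_rw [e1, hD]
    rw [intervalIntegral.integral_finsetSum, intervalIntegral.integral_finsetSum,
      ← Finset.sum_add_distrib, hU]
    · refine Finset.sum_congr rfl fun j _ => ?_
      rw [intervalIntegral.integral_const_mul, intervalIntegral.integral_const_mul,
        heq (ρ j) t ht]
      ring
    · intro j _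
      refine (ContinuousOn.intervalIntegrable ?_).const_mul _
      rw [huI]
      exact ((continuous_sinKernel (ρ j)).comp (by fun_prop : Continuous fun τ => t - τ)).continuousOn.mul
        ((hXc j).mono hsub)
    · intro j _
      refine IntervalIntegrable.const_mul ?_ _
      refine (ha1.mono_set ?_).mul_continuousOn (by fun_prop)
      rw [huI, uIcc_of_le hs.le]; exact hsub
  have hDb : ∀ τ ∈ Icc 0 t, ‖D τ‖ ≤ (B₁ + B₂) * (2 * s + 1) + s * Q * A τ := by
    intro τ hτ
    have hτs := hsub hτ
    have hA0 : 0 ≤ A τ := (norm_nonneg _).trans (hA τ hτs 0 (by simpa using hτs.2))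
    -- This is d'Alembert's formula: `sinKernel` is an average of exponentials over |v| ≤ t - τ.
    -- Such v keep |u + v| + τ ≤ s, so the bound by A applies again.
    have e2 : D τ = (1 / 2) * ∫ v in (-(t - τ))..(t - τ),
        (b₁ τ * W (v + (u + τ)) + b₂ τ * W (v + (u - τ)) + q τ * U τ (u + v)) := by
      have e3 : ∀ v : ℝ, b₁ τ * W (v + (u + τ)) + b₂ τ * W (v + (u - τ)) + q τ * U τ (u + v)
          = ∑ j ∈ J, c j * exp (I * ρ j * u) * X j τ * exp (I * ρ j * v) := by
        intro v
        rw [hW, hU]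
        simp only [Finset.mul_sum, ← Finset.sum_add_distrib]
        refine Finset.sum_congr rfl fun j _ => ?_
        have h1 : I * ρ j * ((v + (u + τ) : ℝ) : ℂ) = I * ρ j * v + I * ρ j * u + I * ρ j * τ := by
          push_cast; ring
        have h2 : I * ρ j * ((v + (u - τ) : ℝ) : ℂ)
            = I * ρ j * v + I * ρ j * u + -(I * ρ j * τ) := by
          push_cast; ring
        have h3 : I * ρ j * ((u + v : ℝ) : ℂ) = I * ρ j * u + I * ρ j * v := by
          push_cast; ring
        rw [h1, h2, h3]
        simp only [Complex.exp_add, hX]; ring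
      simp_rw [e3]
      rw [intervalIntegral.integral_finsetSum
        (fun j _ => Continuous.intervalIntegrable (by fun_prop) _ _), hD, Finset.mul_sum]
      refine Finset.sum_congr rfl fun j _ => ?_
      rw [intervalIntegral.integral_const_mul, sinKernel]
      ring
    have hle : -(t - τ) ≤ t - τ := by linarith [hτ.2]
    have hmaj : Continuous fun v => B₁ * ‖W (v + (u + τ))‖ + B₂ * ‖W (v + (u - τ))‖ + Q * A τ := by
      fun_prop
    have h4 : ‖∫ v in (-(t - τ))..(t - τ),
        (b₁ τ * W (v + (u + τ)) + b₂ τ * W (v + (u - τ)) + q τ * U τ (u + v))‖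
        ≤ ∫ v in (-(t - τ))..(t - τ),
          (B₁ * ‖W (v + (u + τ))‖ + B₂ * ‖W (v + (u - τ))‖ + Q * A τ) := by
      refine intervalIntegral.norm_integral_le_of_norm_le hle ?_ (hmaj.intervalIntegrable _ _)
      filter_upwards with v hv
      refine (norm_add₃_le).trans ?_
      rw [norm_mul, norm_mul, norm_mul]
      have h5 : |u + v| + τ ≤ s := by
        have : |v| ≤ t - τ := abs_le.mpr ⟨hv.1.le, hv.2⟩
        linarith [abs_add_le u v]
      gcongr
      · exact hB₁ τ hτs
      · exact hB₂ τ hτs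
      · exact hQ τ hτs
      · exact hA τ hτs _ h5
    have hi1 : IntervalIntegrable (fun v => B₁ * ‖W (v + (u + τ))‖) volume (-(t - τ)) (t - τ) :=
      Continuous.intervalIntegrable (by fun_prop) _ _
    have hi2 : IntervalIntegrable (fun v => B₂ * ‖W (v + (u - τ))‖) volume (-(t - τ)) (t - τ) :=
      Continuous.intervalIntegrable (by fun_prop) _ _
    rw [intervalIntegral.integral_add (hi1.add hi2) (by simp), intervalIntegral.integral_add hi1 hi2,
      intervalIntegral.integral_const_mul, intervalIntegral.integral_const_mul,
      intervalIntegral.integral_comp_add_right (fun v => ‖W v‖),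
      intervalIntegral.integral_comp_add_right (fun v => ‖W v‖),
      intervalIntegral.integral_const, smul_eq_mul] at h4
    have h6 := integral_norm_le_of_sq (α := -(t - τ) + (u + τ)) (β := t - τ + (u + τ))
      (by linarith [hτ.1]) (by linarith) (by linarith) hWc hJ
    have h7 := integral_norm_le_of_sq (α := -(t - τ) + (u - τ)) (β := t - τ + (u - τ))
      (by linarith) (by linarith) (by linarith [hτ.1]) hWc hJ
    rw [e2, norm_mul]
    have h8 : ‖(1 / 2 : ℂ)‖ = 1 / 2 := by norm_num
    rw [h8]
    have h9 := mul_le_mul_of_nonneg_left h6 hB₁0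
    have h10 := mul_le_mul_of_nonneg_left h7 hB₂0
    have h11 : (t - τ - -(t - τ)) * (Q * A τ) ≤ 2 * s * (Q * A τ) := by
      gcongr; linarith [hτ.1, ht.2]
    have h12 : 0 ≤ (B₁ + B₂) * (2 * s + 1) := by positivity
    nlinarith
  have hint : ‖∫ τ in (0 : ℝ)..t, D τ‖
      ≤ ∫ τ in (0 : ℝ)..t, ((B₁ + B₂) * (2 * s + 1) + s * Q * A τ) := by
    refine intervalIntegral.norm_integral_le_of_norm_le ht.1 ?_
      (Continuous.intervalIntegrable (by fun_prop) _ _)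
    filter_upwards with τ hτ
    exact hDb τ ⟨hτ.1.le, hτ.2⟩
  rw [intervalIntegral.integral_add (by simp) (Continuous.intervalIntegrable (by fun_prop) _ _),
    intervalIntegral.integral_const, smul_eq_mul, sub_zero] at hint
  have hfirst := norm_integral_mul_le_half ht hu haI hWc hJ
  rw [hUt]
  refine (norm_add_le _ _).trans ?_
  have h13 : t * ((B₁ + B₂) * (2 * s + 1)) ≤ s * ((B₁ + B₂) * (2 * s + 1)) := by
    gcongr; exact ht.2
  rw [hC₀]
  linarith

end SturmLiouville
end

/-! ### Volterra equations, evenness in ρ, and integration by parts. -/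

noncomputable section

namespace SturmLiouville

open Complex Set

lemma sinKernel_neg_left (ρ : ℂ) (t : ℝ) : sinKernel (-ρ) t = sinKernel ρ t := by
  have h := intervalIntegral.integral_comp_neg (a := -t) (b := t) fun v : ℝ => exp (I * ρ * v)
  rw [neg_neg] at h
  rw [sinKernel, sinKernel, ← h]
  simp

lemma exp_eq_cos_add_sinKernel (ρ : ℂ) (t : ℝ) :
    exp (I * ρ * t) = Complex.cos (ρ * t) + I * ρ * sinKernel ρ t := by
  rw [mul_assoc I ρ (sinKernel ρ t), mul_sinKernel, mul_assoc, mul_comm I, Complex.exp_mul_I]; ring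

/-- The first term is free of τ and produces the explicit asymptotics. The second is the oscillating
source admitted by `expBound_of_volterra`. -/
lemma mul_sinKernel_sub_mul_exp (ρ : ℂ) (t τ : ℝ) :
    ρ * (sinKernel ρ (t - τ) * exp (I * ρ * τ))
      = -(I / 2) * exp (I * ρ * t) + I / 2 * exp (I * ρ * (2 * τ - t)) := by
  rw [← mul_assoc, mul_sinKernel, Complex.sin]
  have e1 : I * ρ * (t : ℂ) = ρ * (t - τ : ℝ) * I + I * ρ * τ := by push_cast; ring
  have e2 : I * ρ * (2 * τ - t : ℂ) = -(ρ * (t - τ : ℝ)) * I + I * ρ * τ := by push_cast; ring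
  rw [e1, e2, Complex.exp_add, Complex.exp_add]; ring

/-- Variation of constants: a solution of `-y'' + q y = ρ² y` solves a Volterra equation. -/
lemma volterra_of_ode {L : ℝ} {q y y' y'' : ℝ → ℂ} {ρ : ℂ} (hq : ContinuousOn q (Icc 0 L))
    (hy : ∀ t ∈ Icc 0 L, HasDerivWithinAt y (y' t) (Icc 0 L) t) (hy' : ContinuousOn y' (Icc 0 L))
    (hode : ∀ t ∈ Ioo 0 L, HasDerivAt y' (y'' t) t ∧ -y'' t + q t * y t = ρ ^ 2 * y t)
    {t : ℝ} (ht : t ∈ Icc 0 L) :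
    y t = y 0 * Complex.cos (ρ * t) + y' 0 * sinKernel ρ t +
      ∫ τ in (0 : ℝ)..t, sinKernel ρ (t - τ) * (q τ * y τ) := by
  have hyc : ContinuousOn y (Icc 0 L) := fun t ht => (hy t ht).continuousWithinAt
  have hsub : Icc 0 t ⊆ Icc 0 L := Icc_subset_Icc_right ht.2
  have hk : Continuous fun τ => sinKernel ρ (t - τ) :=
    (continuous_sinKernel ρ).comp (by fun_prop)
  have hft := intervalIntegral.integral_eq_sub_of_hasDerivAt_of_le
    (f := fun τ => y τ * Complex.cos (ρ * (t - τ : ℝ)) + y' τ * sinKernel ρ (t - τ))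
    (f' := fun τ => sinKernel ρ (t - τ) * (q τ * y τ)) ht.1 ?_ ?_ ?_
  · rw [hft]
    simp [sinKernel_zero]
  · exact ((hyc.mono hsub).mul (by fun_prop)).add ((hy'.mono hsub).mul hk.continuousOn)
  · intro τ hτ
    have hτL : τ ∈ Ioo 0 L := ⟨hτ.1, hτ.2.trans_le ht.2⟩
    have h1 : HasDerivAt y (y' τ) τ :=
      (hy τ (Ioo_subset_Icc_self hτL)).hasDerivAt (Icc_mem_nhds hτL.1 hτL.2)
    obtain ⟨h2, h3⟩ := hode τ hτL
    have h4 : HasDerivAt (fun τ : ℝ => t - τ) (-1) τ := by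
      simpa using (hasDerivAt_id τ).const_sub t
    have h5 : HasDerivAt (fun τ => sinKernel ρ (t - τ)) _ τ :=
      (hasDerivAt_sinKernel ρ (t - τ)).scomp τ h4
    have h6 : HasDerivAt (fun τ : ℝ => Complex.cos (ρ * (t - τ : ℝ)))
        (-Complex.sin (ρ * (t - τ : ℝ)) * (ρ * -1)) τ := by
      have h : HasDerivAt (fun τ : ℝ => ρ * ((t - τ : ℝ) : ℂ)) (ρ * -1) τ := by
        simpa using (h4.ofReal_comp).const_mul ρ
      exact (Complex.hasDerivAt_cos _).comp τ h
    refine ((h1.mul h6).add (h2.mul h5)).congr_deriv ?_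
    rw [← mul_sinKernel]
    have h7 : y'' τ = q τ * y τ - ρ ^ 2 * y τ := by linear_combination -h3
    rw [h7]
    simp only [neg_smul, one_smul]
    ring
  · refine ContinuousOn.intervalIntegrable ?_
    rw [uIcc_of_le ht.1]
    exact hk.continuousOn.mul ((hq.mono hsub).mul (hyc.mono hsub))

lemma IsSolutionFromRight.volterra {L : ℝ} {q y : ℝ → ℂ} {ρ a b : ℂ}
    (hq : ContinuousOn q (Icc 0 L)) (hy : IsSolutionFromRight L q ρ a b y) :
    ContinuousOn (fun t => y (L - t)) (Icc 0 L) ∧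
    ∀ t ∈ Icc 0 L, y (L - t) = a * Complex.cos (ρ * t) - b * sinKernel ρ t +
      ∫ τ in (0 : ℝ)..t, sinKernel ρ (t - τ) * (q (L - τ) * y (L - τ)) := by
  obtain ⟨y', y'', h1, h2, h3, rfl, rfl⟩ := hy
  have hmap : MapsTo (fun t : ℝ => L - t) (Icc 0 L) (Icc 0 L) := fun t ht =>
    ⟨by linarith [ht.2], by linarith [ht.1]⟩
  have hc : ContinuousOn (fun t : ℝ => L - t) (Icc 0 L) := by fun_prop
  have hd : ∀ t : ℝ, HasDerivAt (fun t : ℝ => L - t) (-1) t := fun t => by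
    simpa using (hasDerivAt_id t).const_sub L
  have hyd : ∀ t ∈ Icc 0 L,
      HasDerivWithinAt (fun t => y (L - t)) (-y' (L - t)) (Icc 0 L) t := by
    intro t ht
    have : HasDerivWithinAt (fun t => y (L - t)) _ (Icc 0 L) t :=
      (h1 (L - t) (hmap ht)).scomp t (hd t).hasDerivWithinAt hmap
    simpa using this
  refine ⟨fun t ht => (hyd t ht).continuousWithinAt, fun t ht => ?_⟩
  have := volterra_of_ode (q := fun t => q (L - t)) (y := fun t => y (L - t))
    (y' := fun t => -y' (L - t)) (y'' := fun t => y'' (L - t)) (ρ := ρ) (hq.comp hc hmap) hyd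
    (h2.comp hc hmap).neg (fun τ hτ => ?_) ht
  · rw [this]
    simp only [sub_zero]; ring
  · obtain ⟨h4, h5⟩ := h3 (L - τ) ⟨by linarith [hτ.2], by linarith [hτ.1]⟩
    have h6 := (h4.scomp τ (hd τ)).neg
    simp only [neg_smul, one_smul, neg_neg] at h6
    exact ⟨h6, h5⟩

/-- This is `wave_bound` for a function constant in u, with no source. -/
lemma eq_zero_of_volterra {s : ℝ} {q d : ℝ → ℂ} {ρ : ℂ} (hq : ContinuousOn q (Icc 0 s))
    (hd : ContinuousOn d (Icc 0 s))
    (h : ∀ t ∈ Icc 0 s, d t = ∫ τ in (0 : ℝ)..t, sinKernel ρ (t - τ) * (q τ * d τ))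
    (hs : 0 ≤ s) : d s = 0 := by
  obtain ⟨Q, hQ⟩ := isCompact_Icc.exists_bound_of_continuousOn hq
  obtain ⟨A₀, hA₀⟩ := isCompact_Icc.exists_bound_of_continuousOn hd
  obtain ⟨K, hK⟩ := (isCompact_Icc (a := (0 : ℝ)) (b := s)).exists_bound_of_continuousOn
    (continuous_sinKernel ρ).continuousOn
  have h0 : (0 : ℝ) ∈ Icc 0 s := ⟨le_rfl, hs⟩
  have hQ0 := (norm_nonneg _).trans (hQ 0 h0)
  have hK0 := (norm_nonneg _).trans (hK 0 h0)
  have := wave_bound (U := fun t _ => d t) (C₀ := 0) (Q := K * Q) (A₀ := A₀) hs (by positivity)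
    (fun t ht _ _ => hA₀ t ht) ?_
  · simpa using this
  intro A hAc hA t ht u hu
  rw [h t ht, zero_add]
  refine intervalIntegral.norm_integral_le_of_norm_le ht.1 ?_
    (Continuous.intervalIntegrable (by fun_prop) _ _)
  filter_upwards with τ hτ
  have hτs : τ ∈ Icc 0 s := ⟨hτ.1.le, hτ.2.trans ht.2⟩
  rw [norm_mul, norm_mul, mul_assoc]
  gcongr
  · exact hK _ ⟨by linarith [hτ.2], by linarith [hτ.1, ht.2]⟩
  · exact hQ τ hτs
  · exact hA τ hτs 0 (by simpa using hτs.2)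

/-- The equation contains only ρ², and `sinKernel` and the cosine are even in ρ. The difference of
the two solutions thus solves a homogeneous Volterra equation. -/
lemma IsSolutionFromRight.eq_of_neg {L : ℝ} {q y z : ℝ → ℂ} {ρ a b : ℂ}
    (hq : ContinuousOn q (Icc 0 L)) (hy : IsSolutionFromRight L q ρ a b y)
    (hz : IsSolutionFromRight L q (-ρ) a b z) {x : ℝ} (hx : x ∈ Icc 0 L) : z x = y x := by
  obtain ⟨hyc, hy⟩ := hy.volterra hq
  obtain ⟨hzc, hz⟩ := hz.volterra hq
  have hs : 0 ≤ L - x := by linarith [hx.2]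
  have hsub : Icc 0 (L - x) ⊆ Icc 0 L := Icc_subset_Icc_right (by linarith [hx.1])
  have hqc : ContinuousOn (fun t => q (L - t)) (Icc 0 L) :=
    hq.comp (by fun_prop) fun t ht => ⟨by linarith [ht.2], by linarith [ht.1]⟩
  have := eq_zero_of_volterra (q := fun t => q (L - t)) (d := fun t => z (L - t) - y (L - t))
    (ρ := ρ) (hqc.mono hsub) ((hzc.sub hyc).mono hsub) (fun t ht => ?_) hs
  · simpa [sub_eq_zero] using this
  have hint : ∀ w : ℝ → ℂ, ContinuousOn (fun t => w (L - t)) (Icc 0 L) →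
      IntervalIntegrable (fun τ => sinKernel ρ (t - τ) * (q (L - τ) * w (L - τ))) volume 0 t := by
    intro w hw
    have hk : Continuous fun τ => sinKernel ρ (t - τ) :=
      (continuous_sinKernel ρ).comp (by fun_prop)
    refine ContinuousOn.intervalIntegrable ?_
    rw [uIcc_of_le ht.1]
    have hsub' : Icc 0 t ⊆ Icc 0 L := (Icc_subset_Icc_right ht.2).trans hsub
    exact hk.continuousOn.mul ((hqc.mono hsub').mul (hw.mono hsub'))
  rw [hy t (hsub ht), hz t (hsub ht)]
  simp only [sinKernel_neg_left, neg_mul, Complex.cos_neg]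
  rw [add_sub_add_left_eq_sub, ← intervalIntegral.integral_sub (hint z hzc) (hint y hyc)]
  congr 1; ext τ; ring

/-- Integration by parts through Fubini on the triangle σ ≤ τ ≤ t: g is merely integrable, so its
primitive need not be differentiable at every point. -/
lemma integral_primitive_mul_deriv {g F F' : ℝ → ℂ} {t : ℝ} (ht : 0 ≤ t)
    (hg : IntegrableOn g (Icc 0 t)) (hF : ∀ τ, HasDerivAt F (F' τ) τ) (hF' : Continuous F') :
    ∫ τ in (0 : ℝ)..t, (∫ σ in (0 : ℝ)..τ, g σ) * F' τ
      = ∫ σ in (0 : ℝ)..t, g σ * (F t - F σ) := by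
  have hgI : Integrable g (volume.restrict (Ioc 0 t)) := hg.mono_set Ioc_subset_Icc_self
  have hF'I : Integrable F' (volume.restrict (Ioc 0 t)) := (hF'.intervalIntegrable 0 t).1
  have hprod := hF'I.mul_prod hgI
  have hset : MeasurableSet {p : ℝ × ℝ | p.2 ≤ p.1} := measurableSet_le measurable_snd measurable_fst
  have hswap := integral_integral_swap (f := fun τ σ =>
    {p : ℝ × ℝ | p.2 ≤ p.1}.indicator (fun p => F' p.1 * g p.2) (τ, σ)) (hprod.indicator hset)
  rw [intervalIntegral.integral_of_le ht, intervalIntegral.integral_of_le ht]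
  refine Eq.trans ?_ (hswap.trans ?_)
  · refine setIntegral_congr_fun measurableSet_Ioc fun τ hτ => ?_
    have e : (fun σ => {p : ℝ × ℝ | p.2 ≤ p.1}.indicator (fun p => F' p.1 * g p.2) (τ, σ))
        = (Iic τ).indicator fun σ => F' τ * g σ := by
      ext σ; simp [indicator]
    simp only [e]
    rw [integral_indicator measurableSet_Iic, Measure.restrict_restrict measurableSet_Iic,
      integral_const_mul, intervalIntegral.integral_of_le hτ.1.le, mul_comm]
    congr 3
    ext σ; simp only [mem_inter_iff, mem_Ioc, mem_Iic]
    exact ⟨fun h => ⟨h.2, h.1, h.2.trans hτ.2⟩, fun h => ⟨h.2.1, h.1⟩⟩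
  · refine setIntegral_congr_fun measurableSet_Ioc fun σ hσ => ?_
    have e : (fun τ => {p : ℝ × ℝ | p.2 ≤ p.1}.indicator (fun p => F' p.1 * g p.2) (τ, σ))
        = (Ici σ).indicator fun τ => F' τ * g σ := by
      ext τ; simp [indicator]
    simp only [e]
    rw [integral_indicator measurableSet_Ici, Measure.restrict_restrict measurableSet_Ici,
      integral_mul_const, mul_comm]
    congr 1
    have hs : Ici σ ∩ Ioc 0 t = Icc σ t := by
      ext τ; simp only [mem_inter_iff, mem_Ioc, mem_Ici, mem_Icc]
      exact ⟨fun h => ⟨h.1, h.2.2⟩, fun h => ⟨h.1, hσ.1.trans_le h.1, h.2⟩⟩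
    rw [hs, integral_Icc_eq_integral_Ioc, ← intervalIntegral.integral_of_le hσ.2]
    exact intervalIntegral.integral_eq_sub_of_hasDerivAt (fun τ _ => hF τ)
      (hF'.intervalIntegrable _ _)

/-- Integration by parts against an exponential. -/
lemma mul_integral_mul_exp {q g : ℝ → ℂ} {s t : ℝ} (ht : t ∈ Icc 0 s)
    (hg : IntegrableOn g (Icc 0 s)) (hq : ∀ x ∈ Icc 0 s, q x = q 0 + ∫ σ in (0 : ℝ)..x, g σ) (ρ : ℂ) :
    ρ * ∫ τ in (0 : ℝ)..t, q τ * exp (I * ρ * (2 * τ - t))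
      = -(I / 2) * (q t * exp (I * ρ * t) - q 0 * exp (-(I * ρ * t))
        - ∫ τ in (0 : ℝ)..t, g τ * exp (I * ρ * (2 * τ - t))) := by
  set F : ℝ → ℂ := fun τ => exp (I * ρ * (2 * τ - t)) with hF
  have hFd : ∀ τ, HasDerivAt F (2 * I * ρ * F τ) τ := by
    intro τ
    have h1 : HasDerivAt (fun τ : ℝ => I * ρ * (2 * (τ : ℂ) - t)) (I * ρ * (2 * 1)) τ :=
      (((hasDerivAt_id τ).ofReal_comp.const_mul 2).sub_const _).const_mul _
    refine h1.cexp.congr_deriv ?_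
    rw [hF]; ring
  have hFc : Continuous F := by rw [hF]; fun_prop
  have hg' : IntegrableOn g (Icc 0 t) := hg.mono_set (Icc_subset_Icc_right ht.2)
  have hgi : IntervalIntegrable g volume 0 t :=
    (intervalIntegrable_iff_integrableOn_Icc_of_le ht.1).mpr hg'
  have hparts := integral_primitive_mul_deriv ht.1 hg' hFd (by fun_prop)
  have hprim : ContinuousOn (fun τ => ∫ σ in (0 : ℝ)..τ, g σ) (Icc 0 t) := by
    have := intervalIntegral.continuousOn_primitive_interval (a := 0) (b := t) (f := g)
      (μ := volume) (by rwa [uIcc_of_le ht.1])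
    rwa [uIcc_of_le ht.1] at this
  have hi1 : IntervalIntegrable (fun τ => (∫ σ in (0 : ℝ)..τ, g σ) * (2 * I * ρ * F τ))
      volume 0 t := by
    refine ContinuousOn.intervalIntegrable ?_
    rw [uIcc_of_le ht.1]; fun_prop
  have hF0 := intervalIntegral.integral_eq_sub_of_hasDerivAt (a := 0) (b := t)
    (fun τ _ => hFd τ) (Continuous.intervalIntegrable (by fun_prop) _ _)
  have e1 : 2 * I * (ρ * ∫ τ in (0 : ℝ)..t, q τ * F τ)
      = (∫ τ in (0 : ℝ)..t, q 0 * (2 * I * ρ * F τ)) +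
        ∫ τ in (0 : ℝ)..t, (∫ σ in (0 : ℝ)..τ, g σ) * (2 * I * ρ * F τ) := by
    rw [← intervalIntegral.integral_add (Continuous.intervalIntegrable (by fun_prop) _ _) hi1,
      ← intervalIntegral.integral_const_mul, ← intervalIntegral.integral_const_mul]
    refine intervalIntegral.integral_congr fun τ hτ => ?_
    rw [uIcc_of_le ht.1] at hτ
    rw [hq τ ⟨hτ.1, hτ.2.trans ht.2⟩]; ring
  have e2 : ∫ σ in (0 : ℝ)..t, g σ * (F t - F σ)
      = (∫ σ in (0 : ℝ)..t, g σ) * F t - ∫ σ in (0 : ℝ)..t, g σ * F σ := by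
    simp_rw [mul_sub]
    rw [intervalIntegral.integral_sub (hgi.mul_const _) (hgi.mul_continuousOn hFc.continuousOn),
      intervalIntegral.integral_mul_const]
  rw [intervalIntegral.integral_const_mul, hF0, hparts, e2] at e1
  have hFt : F t = exp (I * ρ * t) := by rw [hF]; ring_nf
  have hFz : F 0 = exp (-(I * ρ * t)) := by rw [hF]; push_cast; ring_nf
  rw [hFt, hFz] at e1
  rw [hq t ht]
  have hI : I * I = -1 := I_mul_I
  linear_combination (-(I / 2)) * e1 + (ρ * ∫ τ in (0 : ℝ)..t, q τ * F τ) * hI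

end SturmLiouville
end

/-! ### Asymptotic remainders of the solution with initial data 1, iρ. -/

noncomputable section

namespace SturmLiouville

open Complex Set

/-- Half the primitive of the potential. -/
def halfPrimitive (q : ℝ → ℂ) (t : ℝ) : ℂ := (1 / 2) * ∫ σ in (0 : ℝ)..t, q σ

section

variable {s : ℝ} {q : ℝ → ℂ}

lemma intervalIntegrable_of_Icc {f : ℝ → ℂ} {t : ℝ} (ht : t ∈ Icc 0 s)
    (hf : ContinuousOn f (Icc 0 s)) : IntervalIntegrable f volume 0 t := by
  refine ContinuousOn.intervalIntegrable ?_
  rw [uIcc_of_le ht.1]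
  exact hf.mono (Icc_subset_Icc_right ht.2)

lemma continuousOn_halfPrimitive (hs : 0 ≤ s) (hq : ContinuousOn q (Icc 0 s)) :
    ContinuousOn (halfPrimitive q) (Icc 0 s) := by
  have := intervalIntegral.continuousOn_primitive_interval (a := 0) (b := s) (f := q)
    (μ := volume) (by rw [uIcc_of_le hs]; exact hq.integrableOn_Icc)
  rw [uIcc_of_le hs] at this
  exact continuousOn_const.mul this

lemma integral_mul_halfPrimitive (hq : ContinuousOn q (Icc 0 s)) {t : ℝ} (ht : t ∈ Icc 0 s) :
    ∫ τ in (0 : ℝ)..t, q τ * halfPrimitive q τ = halfPrimitive q t ^ 2 := by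
  have hs : 0 ≤ s := ht.1.trans ht.2
  have hc := continuousOn_halfPrimitive hs hq
  have hsub : Icc 0 t ⊆ Icc 0 s := Icc_subset_Icc_right ht.2
  have h := intervalIntegral.integral_eq_sub_of_hasDerivAt_of_le
    (f := fun τ => halfPrimitive q τ ^ 2) (f' := fun τ => q τ * halfPrimitive q τ) ht.1
    ((hc.mono hsub).pow 2) (fun τ hτ => ?_) (intervalIntegrable_of_Icc ht (hq.mul hc))
  · rw [h]; simp [halfPrimitive]
  · have hτs : τ ∈ Ioo 0 s := ⟨hτ.1, hτ.2.trans_le ht.2⟩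
    have hnhds : Icc 0 s ∈ 𝓝 τ := Icc_mem_nhds hτs.1 hτs.2
    have h1 : HasDerivAt (fun t => ∫ σ in (0 : ℝ)..t, q σ) (q τ) τ :=
      intervalIntegral.integral_hasDerivAt_right
        (intervalIntegrable_of_Icc (Ioo_subset_Icc_self hτs) hq)
        ⟨Icc 0 s, hnhds, hq.aestronglyMeasurable measurableSet_Icc⟩ (hq.continuousAt hnhds)
    have h2 : HasDerivAt (halfPrimitive q) (1 / 2 * q τ) τ := h1.const_mul _
    refine (h2.pow 2).congr_deriv ?_
    norm_num; ring

variable {E : ℂ → ℝ → ℂ}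

/-- `E ρ` solves the Volterra equation of the solution of `-y'' + q y = ρ² y` with
`y(0) = 1`, `y'(0) = iρ`. -/
structure IsJostLike (s : ℝ) (q : ℝ → ℂ) (E : ℂ → ℝ → ℂ) : Prop where
  continuousOn : ∀ ρ, ContinuousOn (E ρ) (Icc 0 s)
  volterra : ∀ ρ, ∀ t ∈ Icc 0 s, E ρ t = exp (I * ρ * t) +
    ∫ τ in (0 : ℝ)..t, sinKernel ρ (t - τ) * (q τ * E ρ τ)

/-- The remainder of first order in the expansion of `ρ (E - exp(iρt))`. -/
def firstRemainder (q : ℝ → ℂ) (E : ℂ → ℝ → ℂ) (ρ : ℂ) (t : ℝ) : ℂ :=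
  ρ * (E ρ t - exp (I * ρ * t)) + I * halfPrimitive q t * exp (I * ρ * t)

/-- The remainder of second order in the expansion of `ρ² (E - exp(iρt))`. -/
def secondRemainder (q : ℝ → ℂ) (E : ℂ → ℝ → ℂ) (ρ : ℂ) (t : ℝ) : ℂ :=
  ρ * firstRemainder q E ρ t - (q t / 4 - halfPrimitive q t ^ 2 / 2) * exp (I * ρ * t)
    + q 0 / 4 * exp (-(I * ρ * t))

lemma integral_mul_sinKernel_mul_exp {f : ℝ → ℂ} {t : ℝ} (ht : t ∈ Icc 0 s)
    (hf : ContinuousOn f (Icc 0 s)) (ρ : ℂ) :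
    ρ * ∫ τ in (0 : ℝ)..t, sinKernel ρ (t - τ) * (f τ * exp (I * ρ * τ))
      = -(I / 2) * (∫ τ in (0 : ℝ)..t, f τ) * exp (I * ρ * t)
        + ∫ τ in (0 : ℝ)..t, I / 2 * f τ * exp (I * ρ * (2 * τ - t)) := by
  have h1 : IntervalIntegrable (fun τ => -(I / 2) * exp (I * ρ * t) * f τ) volume 0 t :=
    (intervalIntegrable_of_Icc ht hf).const_mul _
  have h2 : IntervalIntegrable (fun τ : ℝ => I / 2 * f τ * exp (I * ρ * (2 * τ - t)))
      volume 0 t := intervalIntegrable_of_Icc ht (by fun_prop)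
  have e : -(I / 2) * (∫ τ in (0 : ℝ)..t, f τ) * exp (I * ρ * t)
      = ∫ τ in (0 : ℝ)..t, -(I / 2) * exp (I * ρ * t) * f τ := by
    rw [intervalIntegral.integral_const_mul]; ring
  rw [e, ← intervalIntegral.integral_add h1 h2, ← intervalIntegral.integral_const_mul]
  refine intervalIntegral.integral_congr fun τ _ => ?_
  have := mul_sinKernel_sub_mul_exp ρ t τ
  linear_combination f τ * this

namespace IsJostLike

lemma difference_volterra (hE : IsJostLike s q E) (hq : ContinuousOn q (Icc 0 s)) (ρ : ℂ) {t : ℝ}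
    (ht : t ∈ Icc 0 s) : E ρ t - exp (I * ρ * t)
      = (∫ τ in (0 : ℝ)..t, sinKernel ρ (t - τ) * (q τ * exp (I * ρ * τ)))
        + ∫ τ in (0 : ℝ)..t, sinKernel ρ (t - τ) * (q τ * (E ρ τ - exp (I * ρ * τ))) := by
  have hEc := hE.continuousOn ρ
  rw [hE.volterra ρ t ht, add_sub_cancel_left, ← intervalIntegral.integral_add]
  · congr 1; ext τ; ring
  · exact intervalIntegrable_of_Icc ht (by fun_prop)
  · exact intervalIntegrable_of_Icc ht (by fun_prop)

/-- Multiplication by ρ splits the free term into an explicit part, -i `halfPrimitive` q times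
exp(iρt), which the remainder cancels, and an oscillating integral. Under the kernel, ρ(E -
exp(iρτ)) is again the remainder plus an explicit exponential. -/
lemma firstRemainder_volterra (hE : IsJostLike s q E) (hq : ContinuousOn q (Icc 0 s)) (ρ : ℂ)
    {t : ℝ} (ht : t ∈ Icc 0 s) : firstRemainder q E ρ t
      = (∫ τ in (0 : ℝ)..t, I / 2 * q τ * exp (I * ρ * (2 * τ - t)))
        + ∫ τ in (0 : ℝ)..t, sinKernel ρ (t - τ) *
          (-I * q τ * halfPrimitive q τ * exp (I * ρ * τ) + q τ * firstRemainder q E ρ τ) := by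
  rw [firstRemainder, hE.difference_volterra hq ρ ht, mul_add,
    integral_mul_sinKernel_mul_exp ht hq, ← intervalIntegral.integral_const_mul ρ]
  have e : ∀ τ : ℝ, ρ * (sinKernel ρ (t - τ) * (q τ * (E ρ τ - exp (I * ρ * τ))))
      = sinKernel ρ (t - τ) *
          (-I * q τ * halfPrimitive q τ * exp (I * ρ * τ) + q τ * firstRemainder q E ρ τ) := by
    intro τ; rw [firstRemainder]; ring
  simp_rw [e]
  rw [halfPrimitive]; ring

lemma continuousOn_firstRemainder (hE : IsJostLike s q E) (hs : 0 ≤ s)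
    (hq : ContinuousOn q (Icc 0 s)) (ρ : ℂ) : ContinuousOn (firstRemainder q E ρ) (Icc 0 s) := by
  have h1 := hE.continuousOn ρ
  have h2 := continuousOn_halfPrimitive hs hq
  unfold firstRemainder
  fun_prop

lemma continuousOn_secondRemainder (hE : IsJostLike s q E) (hs : 0 ≤ s)
    (hq : ContinuousOn q (Icc 0 s)) (ρ : ℂ) : ContinuousOn (secondRemainder q E ρ) (Icc 0 s) := by
  have h1 := hE.continuousOn_firstRemainder hs hq ρ
  have h2 := continuousOn_halfPrimitive hs hq
  unfold secondRemainder
  fun_prop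

/-- Multiplying by ρ once more gives two explicit contributions. Integration by parts of the
oscillating integral yields q(t)/4 and q(0)/4 at the cost of q' = g, and the integral of q times
`halfPrimitive` q yields the square of `halfPrimitive`. -/
lemma secondRemainder_volterra (hE : IsJostLike s q E) (hq : ContinuousOn q (Icc 0 s))
    {g : ℝ → ℂ} (hg : IntegrableOn g (Icc 0 s))
    (hqg : ∀ x ∈ Icc 0 s, q x = q 0 + ∫ σ in (0 : ℝ)..x, g σ) (ρ : ℂ)
    {t : ℝ} (ht : t ∈ Icc 0 s) : secondRemainder q E ρ t
      = (∫ τ in (0 : ℝ)..t, (-(1 / 4) * g τ + 1 / 2 * (q τ * halfPrimitive q τ))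
          * exp (I * ρ * (2 * τ - t)))
        + ∫ τ in (0 : ℝ)..t, sinKernel ρ (t - τ) *
          (q τ * (q τ / 4 - halfPrimitive q τ ^ 2 / 2) * exp (I * ρ * τ)
            + -(q τ * (q 0 / 4)) * exp (-(I * ρ * τ)) + q τ * secondRemainder q E ρ τ) := by
  have hs : 0 ≤ s := ht.1.trans ht.2
  have hωc := continuousOn_halfPrimitive hs hq
  have hr := hE.continuousOn_firstRemainder hs hq ρ
  have hqω : ContinuousOn (fun τ => q τ * halfPrimitive q τ) (Icc 0 s) := hq.mul hωc
  have h1 := integral_mul_sinKernel_mul_exp ht hqω ρ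
  rw [integral_mul_halfPrimitive hq ht] at h1
  have h2 := mul_integral_mul_exp ht hg hqg ρ
  have hgt : IntervalIntegrable g volume 0 t := by
    rw [intervalIntegrable_iff_integrableOn_Icc_of_le ht.1]
    exact hg.mono_set (Icc_subset_Icc_right ht.2)
  have hge : IntervalIntegrable (fun τ : ℝ => g τ * exp (I * ρ * (2 * τ - t))) volume 0 t :=
    hgt.mul_continuousOn (by fun_prop)
  have hqωe : IntervalIntegrable (fun τ : ℝ => q τ * halfPrimitive q τ * exp (I * ρ * (2 * τ - t)))
      volume 0 t := intervalIntegrable_of_Icc ht (by fun_prop)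
  have e1 : ∫ τ in (0 : ℝ)..t, (-(1 / 4) * g τ + 1 / 2 * (q τ * halfPrimitive q τ))
        * exp (I * ρ * (2 * τ - t))
      = -(1 / 4) * (∫ τ in (0 : ℝ)..t, g τ * exp (I * ρ * (2 * τ - t)))
        + 1 / 2 * ∫ τ in (0 : ℝ)..t, q τ * halfPrimitive q τ * exp (I * ρ * (2 * τ - t)) := by
    rw [← intervalIntegral.integral_const_mul, ← intervalIntegral.integral_const_mul,
      ← intervalIntegral.integral_add (hge.const_mul _) (hqωe.const_mul _)]
    congr 1; ext τ; ring
  have e2 : ∀ τ : ℝ, sinKernel ρ (t - τ) *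
          (q τ * (q τ / 4 - halfPrimitive q τ ^ 2 / 2) * exp (I * ρ * τ)
            + -(q τ * (q 0 / 4)) * exp (-(I * ρ * τ)) + q τ * secondRemainder q E ρ τ)
      = ρ * (sinKernel ρ (t - τ) * (q τ * firstRemainder q E ρ τ)) := by
    intro τ; rw [secondRemainder]; ring
  have e3 : ∫ τ in (0 : ℝ)..t, sinKernel ρ (t - τ) *
        (-I * q τ * halfPrimitive q τ * exp (I * ρ * τ) + q τ * firstRemainder q E ρ τ)
      = -I * (∫ τ in (0 : ℝ)..t, sinKernel ρ (t - τ) *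
          (q τ * halfPrimitive q τ * exp (I * ρ * τ)))
        + ∫ τ in (0 : ℝ)..t, sinKernel ρ (t - τ) * (q τ * firstRemainder q E ρ τ) := by
    rw [← intervalIntegral.integral_const_mul, ← intervalIntegral.integral_add]
    · congr 1; ext τ; ring
    · exact intervalIntegrable_of_Icc ht (by fun_prop)
    · exact intervalIntegrable_of_Icc ht (by fun_prop)
  have e4 : ∫ τ in (0 : ℝ)..t, I / 2 * q τ * exp (I * ρ * (2 * τ - t))
      = I / 2 * ∫ τ in (0 : ℝ)..t, q τ * exp (I * ρ * (2 * τ - t)) := by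
    rw [← intervalIntegral.integral_const_mul]
    congr 1; ext τ; ring
  have e5 : ∫ τ in (0 : ℝ)..t, I / 2 * (q τ * halfPrimitive q τ) * exp (I * ρ * (2 * τ - t))
      = I / 2 * ∫ τ in (0 : ℝ)..t, q τ * halfPrimitive q τ * exp (I * ρ * (2 * τ - t)) := by
    rw [← intervalIntegral.integral_const_mul]
    congr 1; ext τ; ring
  rw [e1]
  simp_rw [e2]
  rw [intervalIntegral.integral_const_mul, secondRemainder, hE.firstRemainder_volterra hq ρ ht,
    e3, e4]
  rw [e5] at h1
  have hI : I ^ 2 = -1 := I_sq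
  generalize (∫ τ in (0 : ℝ)..t, g τ * exp (I * ρ * (2 * τ - t))) = X1 at h2 ⊢
  generalize (∫ τ in (0 : ℝ)..t, q τ * halfPrimitive q τ * exp (I * ρ * (2 * τ - t))) = X2 at h1 ⊢
  generalize (∫ τ in (0 : ℝ)..t, q τ * exp (I * ρ * (2 * τ - t))) = X3 at h2 ⊢
  generalize (∫ τ in (0 : ℝ)..t, sinKernel ρ (t - τ) *
          (q τ * halfPrimitive q τ * exp (I * ρ * τ))) = X4 at h1 ⊢
  linear_combination (-I) * h1 + I / 2 * h2 + (halfPrimitive q t ^ 2 * exp (I * ρ * t) / 2 - X2 / 2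
    - (q t * exp (I * ρ * t) - q 0 * exp (-(I * ρ * t)) - X1) / 4) * hI

lemma expBound_difference (hE : IsJostLike s q E) (hs : 0 < s) (hq : ContinuousOn q (Icc 0 s)) :
    ExpBound s fun ρ => E ρ s - exp (I * ρ * s) := by
  refine expBound_of_volterra (a := 0) (b₁ := q) (b₂ := 0) (q := q)
    (g := fun ρ t => E ρ t - exp (I * ρ * t)) hs (by simp) hq continuousOn_const hq
    (fun ρ => (hE.continuousOn ρ).sub (by fun_prop)) fun ρ t ht => ?_
  have hEc := hE.continuousOn ρ
  simp only [Pi.zero_apply, zero_mul, intervalIntegral.integral_zero, zero_add, add_zero]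
  rw [hE.difference_volterra hq ρ ht, ← intervalIntegral.integral_add]
  · congr 1; ext τ; ring
  · exact intervalIntegrable_of_Icc ht (by fun_prop)
  · exact intervalIntegrable_of_Icc ht (by fun_prop)

lemma expBound_firstRemainder (hE : IsJostLike s q E) (hs : 0 < s)
    (hq : ContinuousOn q (Icc 0 s)) : ExpBound s fun ρ => firstRemainder q E ρ s := by
  have hω := continuousOn_halfPrimitive hs.le hq
  refine expBound_of_volterra (a := fun τ => I / 2 * q τ)
    (b₁ := fun τ => -I * q τ * halfPrimitive q τ) (b₂ := 0) (q := q) hs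
    ?_ (by fun_prop) continuousOn_const hq
    (hE.continuousOn_firstRemainder hs.le hq) fun ρ t ht => ?_
  · have hc : ContinuousOn (fun τ => I / 2 * q τ) (Icc 0 s) := by fun_prop
    rw [memLp_two_iff_integrable_sq_norm (hc.aestronglyMeasurable measurableSet_Icc)]
    exact (hc.norm.pow 2).integrableOn_Icc
  · simp only [Pi.zero_apply, zero_mul, add_zero]
    exact hE.firstRemainder_volterra hq ρ ht

lemma expBound_secondRemainder (hE : IsJostLike s q E) (hs : 0 < s)
    (hq : ContinuousOn q (Icc 0 s)) {g : ℝ → ℂ} (hg : MemLp g 2 (volume.restrict (Icc 0 s)))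
    (hqg : ∀ x ∈ Icc 0 s, q x = q 0 + ∫ σ in (0 : ℝ)..x, g σ) :
    ExpBound s fun ρ => secondRemainder q E ρ s := by
  have hω := continuousOn_halfPrimitive hs.le hq
  refine expBound_of_volterra (q := q) hs ?_ (by fun_prop) (by fun_prop) hq
    (hE.continuousOn_secondRemainder hs.le hq) fun ρ t ht =>
      hE.secondRemainder_volterra hq (hg.integrable (by norm_num)) hqg ρ ht
  refine (hg.const_mul _).add ?_
  have hc : ContinuousOn (fun τ => 1 / 2 * (q τ * halfPrimitive q τ)) (Icc 0 s) := by fun_prop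
  rw [memLp_two_iff_integrable_sq_norm (hc.aestronglyMeasurable measurableSet_Icc)]
  exact (hc.norm.pow 2).integrableOn_Icc

end IsJostLike

end

end SturmLiouville
end

/-! ### Reflection of the potential; identities for sinc and j₁. -/

noncomputable section

namespace SturmLiouville

open Complex Set

lemma MemW12.exists_reflected {L : ℝ} {q : ℝ → ℂ} (hq : MemW12 L q) (hL : 0 ≤ L) :
    ∃ g : ℝ → ℂ, MemLp g 2 (volume.restrict (Icc 0 L)) ∧
      ∀ t ∈ Icc 0 L, q (L - t) = q (L - 0) + ∫ σ in (0 : ℝ)..t, g σ := by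
  obtain ⟨g, hg, h⟩ := hq
  refine ⟨fun t => -g (L - t), ?_, fun t ht => ?_⟩
  · have hmp := (Measure.measurePreserving_sub_left (volume : Measure ℝ) L).restrict_preimage
      (measurableSet_Icc (a := (0 : ℝ)) (b := L))
    have hpre : (fun t : ℝ => L - t) ⁻¹' Icc 0 L = Icc 0 L := by simp
    rw [hpre] at hmp
    exact (hg.comp_measurePreserving hmp).neg
  · have hgi : IntegrableOn g (Icc 0 L) := hg.integrable (by norm_num)
    have hint : ∀ b ∈ Icc 0 L, IntervalIntegrable g volume 0 b := fun b hb => by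
      rw [intervalIntegrable_iff_integrableOn_Icc_of_le hb.1]
      exact hgi.mono_set (Icc_subset_Icc_right hb.2)
    have hLL : L ∈ Icc 0 L := ⟨hL, le_rfl⟩
    have ht' : L - t ∈ Icc 0 L := ⟨by linarith [ht.2], by linarith [ht.1]⟩
    rw [sub_zero, h _ ht', h _ hLL, intervalIntegral.integral_neg,
      intervalIntegral.integral_comp_sub_left (fun σ => g σ), sub_zero,
      ← intervalIntegral.integral_add_adjacent_intervals (hint _ ht')
        ((hint _ ht').symm.trans (hint _ hLL))]
    ring

lemma MemW12.continuousOn {L : ℝ} {q : ℝ → ℂ} (hq : MemW12 L q) (hL : 0 ≤ L) :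
    ContinuousOn q (Icc 0 L) := by
  obtain ⟨g, hg, h⟩ := hq
  have hgi : IntegrableOn g (Icc 0 L) := hg.integrable (by norm_num)
  have := intervalIntegral.continuousOn_primitive_interval (a := 0) (b := L) (f := g)
    (μ := volume) (by rwa [uIcc_of_le hL])
  rw [uIcc_of_le hL] at this
  exact (continuousOn_const.add this).congr h

lemma integral_exp_eq_sinKernel (ρ : ℂ) (t : ℝ) :
    ∫ τ in (0 : ℝ)..t, exp (I * ρ * (2 * τ - t)) = sinKernel ρ t := by
  have h := intervalIntegral.integral_comp_mul_sub (a := 0) (b := t)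
    (fun v : ℝ => exp (I * ρ * v)) (c := 2) two_ne_zero t
  have e : ∀ τ : ℝ, ((2 * τ - t : ℝ) : ℂ) = 2 * τ - t := fun τ => by push_cast; ring
  simp only [e] at h
  rw [h, sinKernel]
  have e1 : 2 * 0 - t = -t := by ring
  have e2 : 2 * t - t = t := by ring
  rw [e1, e2, Complex.real_smul]
  norm_num

/-- The free term `sinKernel` is itself an oscillating source, with density a = 1. -/
lemma expBound_of_sinKernel_volterra {s : ℝ} (hs : 0 < s) {q : ℝ → ℂ}
    (hq : ContinuousOn q (Icc 0 s)) {g : ℂ → ℝ → ℂ} (hg : ∀ ρ, ContinuousOn (g ρ) (Icc 0 s))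
    (heq : ∀ ρ, ∀ t ∈ Icc 0 s, g ρ t = sinKernel ρ t +
      ∫ τ in (0 : ℝ)..t, sinKernel ρ (t - τ) * (q τ * g ρ τ)) : ExpBound s fun ρ => g ρ s := by
  refine expBound_of_volterra (a := 1) (b₁ := 0) (b₂ := 0) (q := q) hs (memLp_const 1)
    continuousOn_const continuousOn_const hq hg fun ρ t ht => ?_
  simp only [Pi.one_apply, one_mul, Pi.zero_apply, zero_mul, zero_add]
  rw [heq ρ t ht, integral_exp_eq_sinKernel]

lemma expBound_sinKernel {s : ℝ} (hs : 0 < s) : ExpBound s fun ρ => sinKernel ρ s :=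
  expBound_of_sinKernel_volterra (q := 0) hs continuousOn_const
    (fun ρ => (continuous_sinKernel ρ).continuousOn) fun ρ t _ => by simp

lemma csinc_mul_div_pi (ρ : ℂ) {s : ℝ} (hs : 0 < s) :
    csinc (ρ * s / Real.pi) = 1 / s * sinKernel ρ s := by
  have hπ : (Real.pi : ℂ) ≠ 0 := by exact_mod_cast Real.pi_ne_zero
  have hs' : (s : ℂ) ≠ 0 := by exact_mod_cast hs.ne'
  by_cases h : ρ = 0
  · subst h
    simp only [csinc, sinKernel]
    simp; field_simp; norm_num
  · have h1 := mul_sinKernel ρ s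
    have h2 : (Real.pi : ℂ) * (ρ * s / Real.pi) = ρ * s := by field_simp
    rw [csinc, if_neg (by simp [h, hs']), h2, ← h1]
    field_simp

/-- At arguments shifted by a half-integer the cosine becomes ± sin(πz). This is how the sine in the
denominator of the series of T arises. -/
lemma csinc_two_mul (y : ℂ) : csinc (2 * y) = Complex.cos (Real.pi * y) * csinc y := by
  have hπ : (Real.pi : ℂ) ≠ 0 := by exact_mod_cast Real.pi_ne_zero
  by_cases h : y = 0
  · simp [h, csinc]
  · have e : (Real.pi : ℂ) * (2 * y) = 2 * (Real.pi * y) := by ring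
    simp only [csinc, h, mul_eq_zero, OfNat.ofNat_ne_zero, or_self, if_false]
    rw [e, Complex.sin_two_mul]
    field_simp

lemma csinc_odd_sub (z : ℂ) (n : ℕ) : csinc (2 * z - 2 * n - 1)
    = (-1) ^ n * Complex.sin (Real.pi * z) * csinc (z - 1 / 2 - n) := by
  have e : 2 * z - 2 * n - 1 = 2 * (z - 1 / 2 - n) := by ring
  have e2 : (Real.pi : ℂ) * (z - 1 / 2 - n) = Real.pi * z - Real.pi / 2 - n * Real.pi := by ring
  rw [e, csinc_two_mul, e2, Complex.cos_antiperiodic.sub_nat_mul_eq n, Complex.cos_sub_pi_div_two]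

lemma csinc_odd_add (z : ℂ) (n : ℕ) : csinc (2 * z + 2 * n + 1)
    = -((-1) ^ n * Complex.sin (Real.pi * z) * csinc (z + 1 / 2 + n)) := by
  have e : 2 * z + 2 * n + 1 = 2 * (z + 1 / 2 + n) := by ring
  have e2 : (Real.pi : ℂ) * (z + 1 / 2 + n) = Real.pi * z + Real.pi / 2 + n * Real.pi := by ring
  rw [e, csinc_two_mul, e2, Complex.cos_antiperiodic.add_nat_mul_eq n, Complex.cos_add_pi_div_two]
  ring

/-- The j₁ term thus differs from a pure cosine term by a sinc, which is a Fourier transform of the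
required kind. -/
lemma mul_sphericalJ1 (w : ℂ) : w * sphericalJ1 w = csinc (w / Real.pi) - Complex.cos w := by
  have hπ : (Real.pi : ℂ) ≠ 0 := by exact_mod_cast Real.pi_ne_zero
  by_cases h : w = 0
  · simp [h, csinc, sphericalJ1]
  · have e : (Real.pi : ℂ) * (w / Real.pi) = w := by field_simp
    simp only [csinc, sphericalJ1, h, div_eq_zero_iff, hπ, or_self, if_false, e]
    field_simp

lemma eventually_sin_mul_ne_zero {a : ℂ} (ha : a ≠ 0) (ρ₀ : ℂ) :
    ∀ᶠ ρ in 𝓝[≠] ρ₀, Complex.sin (ρ * a) ≠ 0 := by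
  by_cases h : Complex.sin (ρ₀ * a) = 0
  · have hd : HasDerivAt (fun ρ => Complex.sin (ρ * a)) (Complex.cos (ρ₀ * a) * (1 * a)) ρ₀ :=
      ((hasDerivAt_id ρ₀).mul_const a).csin
    refine hd.eventually_ne ?_
    have := Complex.sin_sq_add_cos_sq (ρ₀ * a)
    rw [h] at this
    have hc : Complex.cos (ρ₀ * a) ≠ 0 := by
      intro h0; rw [h0] at this; norm_num at this
    simpa using ⟨hc, ha⟩
  · have hc : Continuous fun ρ : ℂ => Complex.sin (ρ * a) := by fun_prop
    exact (hc.continuousAt.eventually_ne h).filter_mono nhdsWithin_le_nhds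

lemma eventually_ne_zero_punctured (ρ₀ : ℂ) : ∀ᶠ ρ in 𝓝[≠] ρ₀, ρ ≠ 0 := by
  by_cases h : ρ₀ = 0
  · subst h; exact self_mem_nhdsWithin
  · exact (eventually_ne_nhds h).filter_mono nhdsWithin_le_nhds

end SturmLiouville
end

/-! ### The remainders of T and ψ. -/

noncomputable section

namespace SturmLiouville

open Complex Set

section

variable {L : ℝ} {q : ℝ → ℂ} {H : ℂ} {T ψ : ℂ → ℝ → ℂ} {x : ℝ}

/-- In the variable t = L - x the initial data of ψ are 1, H and those of T are 0, -1. The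
combination therefore has data 1 and H - (H - iρ) = iρ. -/
lemma isJostLike_of_solutions (hq : ContinuousOn q (Icc 0 L))
    (hT : ∀ ρ : ℂ, IsSolutionFromRight L q ρ 0 1 (T ρ))
    (hψ : ∀ ρ : ℂ, IsSolutionFromRight L q ρ 1 (-H) (ψ ρ)) :
    IsJostLike L (fun t => q (L - t))
      fun ρ t => ψ ρ (L - t) + (H - I * ρ) * T ρ (L - t) := by
  refine ⟨fun ρ => ?_, fun ρ t ht => ?_⟩
  · have h1 := ((hT ρ).volterra hq).1
    have h2 := ((hψ ρ).volterra hq).1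
    exact h2.add (continuousOn_const.mul h1)
  · obtain ⟨hTc, hTv⟩ := (hT ρ).volterra hq
    obtain ⟨hψc, hψv⟩ := (hψ ρ).volterra hq
    have hqc : ContinuousOn (fun t => q (L - t)) (Icc 0 L) :=
      hq.comp (by fun_prop) fun t ht => ⟨by linarith [ht.2], by linarith [ht.1]⟩
    have hk : ContinuousOn (fun τ => sinKernel ρ (t - τ)) (Icc 0 L) := by fun_prop
    have e : ∫ τ in (0 : ℝ)..t, sinKernel ρ (t - τ) * (q (L - τ) *
          (ψ ρ (L - τ) + (H - I * ρ) * T ρ (L - τ)))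
        = (∫ τ in (0 : ℝ)..t, sinKernel ρ (t - τ) * (q (L - τ) * ψ ρ (L - τ)))
          + (H - I * ρ) * ∫ τ in (0 : ℝ)..t, sinKernel ρ (t - τ) * (q (L - τ) * T ρ (L - τ)) := by
      rw [← intervalIntegral.integral_const_mul, ← intervalIntegral.integral_add]
      · congr 1; ext τ; ring
      · exact intervalIntegrable_of_Icc ht (hk.mul (hqc.mul hψc))
      · exact (intervalIntegrable_of_Icc ht (hk.mul (hqc.mul hTc))).const_mul _
    rw [e, exp_eq_cos_add_sinKernel, hTv t ht, hψv t ht]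
    ring

/-- `ρ³` times the error of the three term asymptotics of `T`. -/
def tRemainder (L : ℝ) (q : ℝ → ℂ) (T : ℂ → ℝ → ℂ) (x : ℝ) (ρ : ℂ) : ℂ :=
  ρ ^ 3 * T ρ x - ρ ^ 2 * Complex.sin (ρ * (x - L)) - ρ * Complex.cos (ρ * (x - L)) * omegaL L q x
    - Complex.sin (ρ * (x - L)) * qL L q x

/-- `-ρ²` times the error of the asymptotics of `ψ`. -/
def psiRemainder (L : ℝ) (q : ℝ → ℂ) (H : ℂ) (ψ : ℂ → ℝ → ℂ) (x : ℝ) (ρ : ℂ) : ℂ :=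
  -ρ ^ 2 * ψ ρ x + ρ ^ 2 * Complex.cos (ρ * (L - x))
    + ρ * Complex.sin (ρ * (L - x)) * (H + omegaL L q x)
    - ρ * (L - x) * sphericalJ1 (ρ * (L - x)) * qLH L q H x

lemma halfPrimitive_reflected (L : ℝ) (q : ℝ → ℂ) (x : ℝ) :
    halfPrimitive (fun t => q (L - t)) (L - x) = omegaL L q x := by
  rw [halfPrimitive, omegaL, intervalIntegral.integral_comp_sub_left (fun σ => q σ)]
  simp

lemma exp_eq_cos_add_sin (ρ w : ℂ) :
    exp (I * ρ * w) = Complex.cos (ρ * w) + I * Complex.sin (ρ * w) := by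
  rw [mul_assoc, mul_comm I, Complex.exp_mul_I]; ring

lemma exp_neg_eq_cos_sub_sin (ρ w : ℂ) :
    exp (-(I * ρ * w)) = Complex.cos (ρ * w) - I * Complex.sin (ρ * w) := by
  have := exp_eq_cos_add_sin (-ρ) w
  simpa [sub_eq_add_neg] using this

variable (hL : 0 < L) (hq : MemW12 L q) (hT : ∀ ρ : ℂ, IsSolutionFromRight L q ρ 0 1 (T ρ))
  (hx : x ∈ Ico 0 L)

include hL hq hT hx in
lemma T_neg (ρ : ℂ) : T (-ρ) x = T ρ x :=
  (hT ρ).eq_of_neg (hq.continuousOn hL.le) (hT (-ρ)) (Ico_subset_Icc_self hx)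

include hL hq hT hx in
lemma tRemainder_neg (ρ : ℂ) : tRemainder L q T x (-ρ) = -tRemainder L q T x ρ := by
  simp only [tRemainder, T_neg hL hq hT hx, neg_mul, Complex.sin_neg, Complex.cos_neg]
  ring

include hL hq hT hx in
lemma continuous_T : Continuous fun ρ => T ρ x := by
  have hqc := hq.continuousOn hL.le
  have hs : 0 < L - x := by linarith [hx.2]
  have hsub : Icc 0 (L - x) ⊆ Icc 0 L := Icc_subset_Icc_right (by linarith [hx.1])
  have hqr : ContinuousOn (fun t => q (L - t)) (Icc 0 L) :=
    hqc.comp (by fun_prop) fun t ht => ⟨by linarith [ht.2], by linarith [ht.1]⟩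
  have h := expBound_of_sinKernel_volterra (g := fun ρ t => -T ρ (L - t)) hs (hqr.mono hsub)
    (fun ρ => (((hT ρ).volterra hqc).1.mono hsub).neg) fun ρ t ht => ?_
  · exact (h.continuous hs).neg.congr fun ρ => by simp
  · rw [((hT ρ).volterra hqc).2 t (hsub ht)]
    simp only [mul_neg, intervalIntegral.integral_neg]
    ring

variable (hψ : ∀ ρ : ℂ, IsSolutionFromRight L q ρ 1 (-H) (ψ ρ))

include hL hq hψ hx in
lemma psi_neg (ρ : ℂ) : ψ (-ρ) x = ψ ρ x :=
  (hψ ρ).eq_of_neg (hq.continuousOn hL.le) (hψ (-ρ)) (Ico_subset_Icc_self hx)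

lemma sphericalJ1_neg (w : ℂ) : sphericalJ1 (-w) = -sphericalJ1 w := by
  by_cases h : w = 0
  · simp [h, sphericalJ1]
  · simp only [sphericalJ1, neg_eq_zero, h, if_false, Complex.sin_neg, Complex.cos_neg]
    field_simp
    ring

include hL hq hψ hx in
lemma psiRemainder_neg (ρ : ℂ) : psiRemainder L q H ψ x (-ρ) = psiRemainder L q H ψ x ρ := by
  simp only [psiRemainder, psi_neg hL hq hx hψ, neg_mul, Complex.sin_neg, Complex.cos_neg,
    sphericalJ1_neg]
  ring

lemma IsJostLike.mono {s s' : ℝ} {q : ℝ → ℂ} {E : ℂ → ℝ → ℂ} (hE : IsJostLike s q E)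
    (h : s' ≤ s) : IsJostLike s' q E :=
  have hsub : Icc 0 s' ⊆ Icc 0 s := Icc_subset_Icc_right h
  ⟨fun ρ => (hE.continuousOn ρ).mono hsub, fun ρ t ht => hE.volterra ρ t (hsub ht)⟩

include hL hq hT hψ hx in
lemma continuous_psi : Continuous fun ρ => ψ ρ x := by
  have hqc := hq.continuousOn hL.le
  have hs : 0 < L - x := by linarith [hx.2]
  have hsub : Icc 0 (L - x) ⊆ Icc 0 L := Icc_subset_Icc_right (by linarith [hx.1])
  have hqr : ContinuousOn (fun t => q (L - t)) (Icc 0 L) :=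
    hqc.comp (by fun_prop) fun t ht => ⟨by linarith [ht.2], by linarith [ht.1]⟩
  have hE := (isJostLike_of_solutions hqc hT hψ).mono (s' := L - x) (by linarith [hx.1])
  have h := (hE.expBound_difference hs (hqr.mono hsub)).continuous hs
  have hTc := continuous_T hL hq hT hx
  have h2 : Continuous fun ρ : ℂ => exp (I * ρ * (L - x : ℝ)) := by fun_prop
  have h3 : Continuous fun ρ : ℂ => (H - I * ρ) * T ρ x := by fun_prop
  refine ((h.add h2).sub h3).congr fun ρ => ?_
  simp

include hL hq hT hψ hx in
-- By evenness of T and ψ, E(ρ) - E(-ρ) = -2iρT and E(ρ) + E(-ρ) = 2(ψ + HT). The odd part of the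
-- second remainder isolates ρ³T.
lemma expBound_remainders : ExpBound (L - x) (tRemainder L q T x) ∧
    ExpBound (L - x) (psiRemainder L q H ψ x) := by
  have hqc := hq.continuousOn hL.le
  have hs : 0 < L - x := by linarith [hx.2]
  have hsub : Icc 0 (L - x) ⊆ Icc 0 L := Icc_subset_Icc_right (by linarith [hx.1])
  have hqr : ContinuousOn (fun t => q (L - t)) (Icc 0 (L - x)) :=
    (hqc.comp (by fun_prop) fun t ht => ⟨by linarith [ht.2], by linarith [ht.1]⟩ :
      ContinuousOn (fun t => q (L - t)) (Icc 0 L)).mono hsub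
  obtain ⟨g, hg, hqg⟩ := hq.exists_reflected hL.le
  have hE := (isJostLike_of_solutions hqc hT hψ).mono (s' := L - x) (by linarith [hx.1])
  have h1 := hE.expBound_firstRemainder hs hqr
  have h2 := hE.expBound_secondRemainder hs hqr
    (hg.mono_measure (Measure.restrict_mono hsub le_rfl)) fun t ht => hqg t (hsub ht)
  have hTn := T_neg hL hq hT hx
  have hψn := psi_neg hL hq hx hψ
  have hI : I ^ 2 = -1 := I_sq
  have hsin : ∀ ρ : ℂ, Complex.sin (ρ * (x - L)) = -Complex.sin (ρ * (L - x)) := fun ρ => by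
    rw [← Complex.sin_neg]; congr 1; ring
  have hcos : ∀ ρ : ℂ, Complex.cos (ρ * (x - L)) = Complex.cos (ρ * (L - x)) := fun ρ => by
    rw [← Complex.cos_neg]; congr 1; ring
  have hk := expBound_sinKernel hs
  constructor
  · refine ((h2.add (h2.comp_neg.const_mul (-1))).const_mul (I / 2)).congr fun ρ => ?_
    simp only [secondRemainder, firstRemainder, tRemainder, halfPrimitive_reflected, mul_neg,
      neg_mul, exp_neg_eq_cos_sub_sin, exp_eq_cos_add_sin, neg_neg, sub_sub_cancel, hTn, hψn, hsin,
      hcos, ofReal_sub, qL, sub_zero]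
    linear_combination (ρ ^ 3 * T ρ x + ρ ^ 2 * Complex.sin (ρ * (L - x))
      - ρ * omegaL L q x * Complex.cos (ρ * (L - x))
      + Complex.sin (ρ * (L - x)) * ((q x + q L) / 4 - omegaL L q x ^ 2 / 2)) * hI
  -- The even part of the second remainder gives -ρ²(ψ + HT), and the first remainder, weighted by
  -- H, removes the HT. The last summand is the sinc contained in the j₁ term.
  · refine ((((h2.add h2.comp_neg).const_mul (-(1 / 2))).add
      ((h1.add h1.comp_neg).const_mul (I / 2 * H))).add
      (hk.const_mul (-(qLH L q H x) * (1 / (L - x : ℝ))))).congr fun ρ => ?_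
    have hj := mul_sphericalJ1 (ρ * (L - x : ℝ))
    rw [csinc_mul_div_pi ρ hs] at hj
    push_cast at hj
    rw [psiRemainder, hj]
    simp only [secondRemainder, firstRemainder, halfPrimitive_reflected, mul_neg,
      neg_mul, exp_neg_eq_cos_sub_sin, exp_eq_cos_add_sin, neg_neg, sub_sub_cancel, hTn, hψn,
      ofReal_sub, qLH, sub_zero]
    linear_combination (H * (ρ ^ 2 * T ρ x + ρ * Complex.sin (ρ * (L - x))
      - omegaL L q x * Complex.cos (ρ * (L - x)))
      + ρ * Complex.sin (ρ * (L - x)) * omegaL L q x) * hI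

end

end SturmLiouville
end

/-! ### Identification of coefficients and terms of the two series. -/

noncomputable section

namespace SturmLiouville

open Complex Set

section

variable {L : ℝ} {q : ℝ → ℂ} {H : ℂ} {T ψ : ℂ → ℝ → ℂ} {x : ℝ}

lemma sin_odd_mul_half_pi (n : ℕ) {d : ℂ} (hd : d ≠ 0) :
    Complex.sin ((2 * n + 1) / (2 * d) * Real.pi * d) = (-1) ^ n := by
  have e : (2 * n + 1) / (2 * d) * Real.pi * d = Real.pi / 2 + n * Real.pi := by
    field_simp; ring
  rw [e, Complex.sin_antiperiodic.add_nat_mul_eq n, Complex.sin_pi_div_two, mul_one]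

lemma cos_odd_mul_half_pi (n : ℕ) {d : ℂ} (hd : d ≠ 0) :
    Complex.cos ((2 * n + 1) / (2 * d) * Real.pi * d) = 0 := by
  have e : (2 * n + 1) / (2 * d) * Real.pi * d = Real.pi / 2 + n * Real.pi := by
    field_simp; ring
  rw [e, Complex.cos_antiperiodic.add_nat_mul_eq n, Complex.cos_pi_div_two, mul_zero]

lemma neg_one_pow_mul_self (n : ℕ) : ((-1 : ℂ) ^ n) * (-1) ^ n = 1 := by
  rw [← mul_pow]; simp

/-- At these nodes the cosine vanishes and the sine is (-1)ⁿ, so the ω_L term is absent. -/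
lemma tCoeff_eq (hxL : (x : ℂ) - L ≠ 0) (n : ℕ) : tCoeff L q T x n
    = -2 * (-1) ^ n * tRemainder L q T x ((2 * n + 1) / (2 * ((x : ℂ) - L)) * Real.pi) := by
  rw [tRemainder, sin_odd_mul_half_pi n hxL, cos_odd_mul_half_pi n hxL, tCoeff]
  have h := neg_one_pow_mul_self n
  have e : ((2 * n + 1) * Real.pi) ^ 3 / (4 * ((x : ℂ) - L) ^ 3)
      = 2 * ((2 * n + 1) / (2 * ((x : ℂ) - L)) * Real.pi) ^ 3 := by
    field_simp; norm_num; ring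
  have e2 : (2 * n + 1) / ((x : ℂ) - L) * Real.pi
      = 2 * ((2 * n + 1) / (2 * ((x : ℂ) - L)) * Real.pi) := by
    field_simp
  rw [e, e2]
  generalize (2 * (n : ℂ) + 1) / (2 * ((x : ℂ) - L)) * Real.pi = r
  rw [pow_succ]
  linear_combination (-2 * r ^ 2 - 2 * qL L q x) * h

/-- At these nodes the sine vanishes, and so does the sinc inside j₁, since n ≠ 0. Only cosines
remain. -/
lemma psiCoeff_eq (hxL : (x : ℂ) - L ≠ 0) {n : ℕ} (hn : n ≠ 0) :
    psiCoeff L q H ψ x n = psiRemainder L q H ψ x (n * Real.pi / ((x : ℂ) - L)) := by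
  have hπ : (Real.pi : ℂ) ≠ 0 := by exact_mod_cast Real.pi_ne_zero
  have e : n * Real.pi / ((x : ℂ) - L) * (L - x) = -(n * Real.pi) := by
    field_simp; ring
  have hj := mul_sphericalJ1 (n * Real.pi / ((x : ℂ) - L) * (L - x))
  have hcos : Complex.cos (-(n * Real.pi)) = (-1) ^ n := by
    rw [Complex.cos_neg]
    have := Complex.cos_antiperiodic.add_nat_mul_eq (x := 0) n
    simpa using this
  have hsin : Complex.sin (-(n * Real.pi)) = 0 := by
    rw [Complex.sin_neg, Complex.sin_nat_mul_pi, neg_zero]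
  have hc : csinc (-(n * Real.pi) / Real.pi) = 0 := by
    rw [neg_div, mul_div_cancel_right₀ _ hπ, csinc_neg]
    exact_mod_cast csinc_intCast (k := n) (by exact_mod_cast hn)
  rw [psiRemainder, hj, e, hcos, hsin, hc, psiCoeff]
  ring

variable (hL : 0 < L) (hq : MemW12 L q) (hT : ∀ ρ : ℂ, IsSolutionFromRight L q ρ 0 1 (T ρ))
  (hx : x ∈ Ico 0 L) (hψ : ∀ ρ : ℂ, IsSolutionFromRight L q ρ 1 (-H) (ψ ρ))

include hL hq hT hψ hx in
/-- The cardinal series of `T` divided by `2 sin(ρ(L - x))`. -/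
lemma exists_tSeries : ∃ v : ℕ → ℂ → ℂ, CardinalConverges v (tRemainder L q T x) ∧
    ∀ n ρ, tTerm L q T x n ρ = 2 * Complex.sin (ρ * (L - x)) * v n ρ := by
  have hs : 0 < L - x := by linarith [hx.2]
  have hs' : ((L - x : ℝ) : ℂ) ≠ 0 := by exact_mod_cast hs.ne'
  have hs'' : (L : ℂ) - x ≠ 0 := by exact_mod_cast hs'
  have hxL : (x : ℂ) - L ≠ 0 := by rw [← neg_sub, neg_ne_zero]; exact_mod_cast hs'
  have hπ : (Real.pi : ℂ) ≠ 0 := by exact_mod_cast Real.pi_ne_zero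
  have hcs := (expBound_remainders hL hq hT hx hψ).1.isCardinalSum hs (1 / 2)
  set f := tRemainder L q T x with hf
  let w : ℤ → ℂ → ℂ := fun k ρ => f (Real.pi * (k + (1 / 2 : ℝ)) / (L - x : ℝ)) *
    csinc (ρ * (L - x : ℝ) / Real.pi - (1 / 2 : ℝ) - k)
  refine ⟨fun n ρ => w n ρ + w (-n - 1) ρ, hcs.cardinalConverges (a := fun n => n)
    (b := fun n => -n - 1) tendsto_Ico_neg_atTop (fun N ρ => ?_)
    (fun m n h => by simpa using h) (fun m n h => by simpa using h) fun n ρ => rfl, fun n ρ => ?_⟩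
  · exact (sum_Ico_neg_eq (fun k => w k ρ) N).symm
  -- The remainder is odd, so the opposite nodes n and -n - 1 carry opposite values, which matches
  -- the opposite signs in `csinc_odd_sub` and `csinc_odd_add`.
  · have hnode : f (Real.pi * (((n : ℤ) : ℂ) + (1 / 2 : ℝ)) / (L - x : ℝ))
        = -f ((2 * n + 1) / (2 * ((x : ℂ) - L)) * Real.pi) := by
      rw [← tRemainder_neg hL hq hT hx]
      congr 1; push_cast
      rw [← neg_sub (x : ℂ) L]; field_simp
    have hnode' : f (Real.pi * (((-n - 1 : ℤ) : ℂ) + (1 / 2 : ℝ)) / (L - x : ℝ))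
        = f ((2 * n + 1) / (2 * ((x : ℂ) - L)) * Real.pi) := by
      congr 1; push_cast
      rw [← neg_sub (x : ℂ) L]; field_simp; ring
    have harg1 : csinc (2 * ρ * ((x : ℂ) - L) / Real.pi - 2 * n - 1)
        = csinc (2 * (ρ * (L - x) / Real.pi) + 2 * n + 1) := by
      rw [← csinc_neg]; congr 1; ring
    have harg2 : csinc (2 * ρ * ((x : ℂ) - L) / Real.pi + 2 * n + 1)
        = csinc (2 * (ρ * (L - x) / Real.pi) - 2 * n - 1) := by
      rw [← csinc_neg]; congr 1; ring
    have hπz : (Real.pi : ℂ) * (ρ * (L - x) / Real.pi) = ρ * (L - x) := by field_simp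
    have hw1 : ρ * ((L - x : ℝ) : ℂ) / Real.pi - (1 / 2 : ℝ) - ((n : ℤ) : ℂ)
        = ρ * (L - x) / Real.pi - 1 / 2 - n := by push_cast; ring
    have hw2 : ρ * ((L - x : ℝ) : ℂ) / Real.pi - (1 / 2 : ℝ) - ((-n - 1 : ℤ) : ℂ)
        = ρ * (L - x) / Real.pi + 1 / 2 + n := by push_cast; ring
    simp only [w]
    rw [hnode, hnode', hw1, hw2, tTerm, tCoeff_eq hxL, ← hf, harg1, harg2, csinc_odd_add,
      csinc_odd_sub, hπz]
    have h := neg_one_pow_mul_self n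
    generalize f ((2 * n + 1) / (2 * ((x : ℂ) - L)) * Real.pi) = y
    generalize csinc (ρ * (L - x) / Real.pi - 1 / 2 - n) = c1
    generalize csinc (ρ * (L - x) / Real.pi + 1 / 2 + n) = c2
    linear_combination (2 * y * Complex.sin (ρ * (L - x)) * (c2 - c1)) * h

include hL hq hT hψ hx in
-- The remainder is even, so opposite nodes share a coefficient. It vanishes at ρ = 0 because of the
-- factor ρ before j₁, so the node k = 0 contributes nothing and the series starts at 1.
lemma cardinalConverges_psiTerm :
    CardinalConverges (fun n => psiTerm L q H ψ x (n + 1)) (psiRemainder L q H ψ x) := by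
  have hs : 0 < L - x := by linarith [hx.2]
  have hs' : ((L - x : ℝ) : ℂ) ≠ 0 := by exact_mod_cast hs.ne'
  have hs'' : (L : ℂ) - x ≠ 0 := by exact_mod_cast hs'
  have hxL : (x : ℂ) - L ≠ 0 := by rw [← neg_sub, neg_ne_zero]; exact_mod_cast hs'
  have hπ : (Real.pi : ℂ) ≠ 0 := by exact_mod_cast Real.pi_ne_zero
  have hcs := (expBound_remainders hL hq hT hx hψ).2.isCardinalSum hs 0
  set f := psiRemainder L q H ψ x with hf
  let w : ℤ → ℂ → ℂ := fun k ρ => f (Real.pi * (k + (0 : ℝ)) / (L - x : ℝ)) *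
    csinc (ρ * (L - x : ℝ) / Real.pi - (0 : ℝ) - k)
  have hterm : ∀ (n : ℕ) ρ, psiTerm L q H ψ x (n + 1) ρ = w (n + 1) ρ + w (-(n + 1)) ρ := by
    intro n ρ
    have hnode : f (Real.pi * (((n + 1 : ℤ) : ℂ) + (0 : ℝ)) / (L - x : ℝ))
        = f ((n + 1 : ℕ) * Real.pi / ((x : ℂ) - L)) := by
      rw [hf, ← psiRemainder_neg hL hq hx hψ]
      congr 1; push_cast
      rw [← neg_sub (x : ℂ) L]; field_simp; ring
    have hnode' : f (Real.pi * (((-(n + 1) : ℤ) : ℂ) + (0 : ℝ)) / (L - x : ℝ))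
        = f ((n + 1 : ℕ) * Real.pi / ((x : ℂ) - L)) := by
      congr 1; push_cast
      rw [← neg_sub (x : ℂ) L]; field_simp; ring
    have harg1 : csinc (ρ * ((x : ℂ) - L) / Real.pi - (n + 1 : ℕ))
        = csinc (ρ * (L - x : ℝ) / Real.pi - (0 : ℝ) - ((-(n + 1) : ℤ) : ℂ)) := by
      rw [← csinc_neg]; congr 1; push_cast; ring
    have harg2 : csinc (ρ * ((x : ℂ) - L) / Real.pi + (n + 1 : ℕ))
        = csinc (ρ * (L - x : ℝ) / Real.pi - (0 : ℝ) - ((n + 1 : ℤ) : ℂ)) := by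
      rw [← csinc_neg]; congr 1; push_cast; ring
    simp only [w]
    rw [hnode, hnode', psiTerm, psiCoeff_eq hxL n.succ_ne_zero, harg1, harg2, ← hf]
    ring
  have hzero : ∀ ρ, w 0 ρ = 0 := by
    intro ρ
    simp [w, hf, psiRemainder]
  refine hcs.cardinalConverges (a := fun n => n + 1) (b := fun n => -(n + 1))
    tendsto_Icc_neg_atTop (fun N ρ => ?_) (fun m n h => by simpa using h)
    (fun m n h => by simpa using h) fun n ρ => hterm n ρ
  rw [Finset.sum_congr rfl fun n _ => hterm n ρ]
  have := sum_Icc_neg_eq (fun k => w k ρ) N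
  rw [hzero, zero_add] at this
  exact this.symm

end

end SturmLiouville

end

/-! ### The main theorem. -/

open SturmLiouville in
/-- Refined cardinal series of `T(ρ, x)` and `ψ(ρ, x)`. The identities hold wherever the right-hand
side is defined, and at the remaining (removable) points `ρ₀` in the sense of limits. For `T` the
convergence is asserted both for the series of sinc functions and for the same series with the
factor `1 / (2 sin(ρ(x - L)))` taken inside (terms being `0` here at the zeros of the sine). -/
theorem mainTheorem8 (L : ℝ) (hL : 0 < L) (q : ℝ → ℂ) (hq : MemW12 L q) (H : ℂ)
    (T ψ : ℂ → ℝ → ℂ)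
    (hT : ∀ ρ : ℂ, IsSolutionFromRight L q ρ 0 1 (T ρ))
    (hψ : ∀ ρ : ℂ, IsSolutionFromRight L q ρ 1 (-H) (ψ ρ))
    (x : ℝ) (hx : x ∈ Set.Ico 0 L) :
    (∃ F : ℂ → ℂ,
      CardinalConverges (tTerm L q T x) F ∧
      CardinalConverges (fun n ρ => tTerm L q T x n ρ / (2 * Complex.sin (ρ * (x - L))))
        (fun ρ => F ρ / (2 * Complex.sin (ρ * (x - L)))) ∧
      (∀ ρ : ℂ, ρ ≠ 0 → Complex.sin (ρ * (x - L)) ≠ 0 →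
        T ρ x = tExpansion L q x (F ρ) ρ) ∧
      (∀ ρ₀ : ℂ, Tendsto (fun ρ => tExpansion L q x (F ρ) ρ) (𝓝[≠] ρ₀) (𝓝 (T ρ₀ x)))) ∧
    (∃ G : ℂ → ℂ,
      CardinalConverges (fun n => psiTerm L q H ψ x (n + 1)) G ∧
      (∀ ρ : ℂ, ρ ≠ 0 → ψ ρ x = psiExpansion L q H x (G ρ) ρ) ∧
      (∀ ρ₀ : ℂ, Tendsto (fun ρ => psiExpansion L q H x (G ρ) ρ) (𝓝[≠] ρ₀) (𝓝 (ψ ρ₀ x)))) := by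
  have hs : 0 < L - x := by linarith [hx.2]
  have hs' : ((L - x : ℝ) : ℂ) ≠ 0 := by exact_mod_cast hs.ne'
  have hxL : (x : ℂ) - L ≠ 0 := by rw [← neg_sub, neg_ne_zero]; exact_mod_cast hs'
  have hsin : ∀ ρ : ℂ, Complex.sin (ρ * (L - x)) = -Complex.sin (ρ * (x - L)) := fun ρ => by
    rw [← Complex.sin_neg]; congr 1; ring
  constructor
  · obtain ⟨v, hv, hterm⟩ := exists_tSeries hL hq hT hx hψ
    set f := tRemainder L q T x with hf
    have hrep : ∀ ρ : ℂ, ρ ≠ 0 → Complex.sin (ρ * (x - L)) ≠ 0 →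
        T ρ x = tExpansion L q x (2 * Complex.sin (ρ * (L - x)) * f ρ) ρ := by
      intro ρ hρ hsρ
      rw [tExpansion, hsin, hf, tRemainder]
      field_simp
      ring
    refine ⟨fun ρ => 2 * Complex.sin (ρ * (L - x)) * f ρ, ?_, ?_, hrep, fun ρ₀ => ?_⟩
    · have hc : Continuous fun ρ : ℂ => 2 * Complex.sin (ρ * (L - x)) := by fun_prop
      refine (hv.mul (b := fun ρ => 2 * Complex.sin (ρ * (L - x))) (B := 2)
        (fun K hK => hK.exists_bound_of_continuousOn hc.continuousOn) (fun r => ?_) ?_).congr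
        hterm fun ρ => rfl
      · have e : (r : ℂ) * (L - x) = ((r * (L - x) : ℝ) : ℂ) := by push_cast; ring
        rw [e, ← Complex.ofReal_sin, norm_mul, Complex.norm_real, Real.norm_eq_abs]
        have := Real.abs_sin_le_one (r * (L - x))
        norm_num
        linarith
      · exact (hc.comp Complex.continuous_ofReal).measurable
    · have hc : Continuous fun r : ℝ => Complex.sin ((r : ℂ) * (x - L)) := by fun_prop
      -- Off the zeros of the sine the factor is the quotient sin(ρ(L - x)) / sin(ρ(x - L)) = -1. At
      -- the zeros, division by zero makes every term 0.
      refine (hv.mul (b := fun ρ => if Complex.sin (ρ * (x - L)) = 0 then 0 else -1) (B := 1)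
        (fun K _ => ⟨1, fun ρ _ => ?_⟩) (fun r => ?_) ?_).congr (fun n ρ => ?_) fun ρ => ?_
      · split_ifs <;> simp
      · split_ifs <;> simp
      · exact Measurable.ite (hc.measurable (measurableSet_singleton 0)) measurable_const
          measurable_const
      · rw [hterm, hsin]
        split_ifs with h
        · simp [h]
        · field_simp
      · simp only [hsin]
        split_ifs with h
        · simp [h]
        · field_simp
    -- T is continuous in ρ, and the excluded points are isolated, so the identity holds on a
    -- punctured neighbourhood of ρ₀.
    · refine (((continuous_T hL hq hT hx).tendsto ρ₀).mono_left nhdsWithin_le_nhds).congr' ?_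
      filter_upwards [eventually_sin_mul_ne_zero hxL ρ₀, eventually_ne_zero_punctured ρ₀]
        with ρ h1 h2 using hrep ρ h2 h1
  · have hrep : ∀ ρ : ℂ, ρ ≠ 0 →
        ψ ρ x = psiExpansion L q H x (psiRemainder L q H ψ x ρ) ρ := by
      intro ρ hρ
      rw [psiExpansion, psiRemainder]
      field_simp
      ring
    refine ⟨psiRemainder L q H ψ x, cardinalConverges_psiTerm hL hq hT hx hψ, hrep, fun ρ₀ => ?_⟩
    refine (((continuous_psi hL hq hT hx hψ).tendsto ρ₀).mono_left nhdsWithin_le_nhds).congr' ?_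
    filter_upwards [eventually_ne_zero_punctured ρ₀] with ρ h using hrep ρ h
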